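/- **Setting.** Let $\mathbb T^2=\mathbb R^2/\mathbb Z^2$ with Lebesgue measure $\mu$, fix $\rho>0$, and put $\Omega_\rho=\{z\in\mathbb C^2: |\operatorname{Im} z_1|<\rho,\ |\operatorname{Im} z_2|<\rho\}$. Let $C^\omega_\rho$ be the set of $\mathbb Z^2$-periodic functions $\mathbb R^2\to\mathbb R$ having a bounded holomorphic extension to $\Omega_\rho$, with $\|f\|_\rho$ the supremum of the modulus of the extension. $\mathrm{Diff}^\omega_\rho(\mathbb T^2,\mu)$ consists of the $\mu$-preserving bijections $f$ of $\mathbb T^2$ such that $f$ and $f^{-1}$ have lifts of the form $x\mapsto x+(f_1(x),f_2(x))$ with $f_i\in C^\omega_\rho$; $d_\rho(f,g)=\max\{\tilde d_\rho(f,g),\tilde d_\rho(f^{-1},g^{-1})\}$ where $\tilde d_\rho(f,g)=\max_i\inf_{n\in\mathbb Z}\|f_i-g_i+n\|_\rho$; and $\mathrm{Diff}^\omega_\infty=\bigcap_{n\ge1}\mathrm{Diff}^\omega_n$. Let $R^t(x_1,x_2)=(x_1+t,x_2)$. Fix positive numbers $(\varepsilon_n)_{n\ge 0}$ with $\sum_n\varepsilon_n<\infty$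 and $\sum_{m>n}\varepsilon_m<\varepsilon_n/2$ for all $n$. **Circular construction sequences.** Given $k_n,l_n$ put $p_0=0$, $q_0=1$, $p_{n+1}=p_nq_nk_nl_n+1$, $q_{n+1}=k_nl_nq_n^2$, $\alpha_n=p_n/q_n$. For $0\le i<q_n$ let $j_i\in[0,q_n)$ be such that $p_nj_i\equiv i \pmod{q_n}$, and put $\mathcal C_n(w_0,\dots,w_{k_n-1})=\prod_{i=0}^{q_n-1}\prod_{j=0}^{k_n-1} b^{q_n-j_i}w_j^{l_n-1}e^{j_i}$. A circular construction sequence in a finite nonempty alphabet $\Sigma$ is a sequence of finite sets of words in $\Sigma\cup\{b,e\}$ with $\mathcal W_0=\Sigma$ and $\mathcal W_{n+1}=\mathcal C_n(P_{n+1})$ for some $P_{n+1}\subseteq\mathcal W_n^{k_n}$, such that: $P_{n+1}$ is uniquely readable over the alphabet $\mathcal W_n$ (if $uv=pws$ with $u,v,w\in P_{n+1}$ then $p$ or $s$ is empty); each word of $\mathcal W_{n+1}$ contains each word of $\mathcal W_n$; and for some positive summable $(\delta_n)$ each word of $\mathcal W_{n+1}$ is a concatenation of words of $\mathcal W_n$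 and spacers of total length less than $\delta_{n+1}q_{n+1}$. With $s_n=|\mathcal W_n|$ we assume that $k_n,l_n,s_n\to\infty$, that $s_n$ divides $k_n$ and $s_{n+1}$, and that each word of $\mathcal W_n$ occurs exactly $k_n/s_n$ times in each tuple of $P_{n+1}$. **The realization.** List each $\mathcal W_n$. Let $h_{n+1}$ be a permutation of the rectangles $[\frac t{k_nq_n},\frac{t+1}{k_nq_n})\times[\frac i{s_{n+1}},\frac{i+1}{s_{n+1}})$, $t<k_n$, $i<s_{n+1}$, extended to $\mathbb T^2$ so as to commute with $R^{1/q_n}$, that sends the rectangle with indices $(t,i)$ into $[0,\frac1{q_n})\times[\frac j{s_n},\frac{j+1}{s_n})$, where the $t$-th word of the tuple forming the $i$-th word of $\mathcal W_{n+1}$ is the $j$-th word of $\mathcal W_n$. Let $h^{(\mathfrak a)}_{n+1}\in\mathrm{Diff}^\omega_\infty$ commute with $R^{1/q_n}$ and $\varepsilon_{n+1}$-approximate $h_{n+1}$: off a set of measure less than $\varepsilon_{n+1}$ it sends each rectangle into its image under $h_{n+1}$. All choices (of the listings, of $h_{n+1}$ given the tuples, of $h_{n+1}^{(\mathfrak a)}$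 given $n,k_n,q_n,s_{n+1},h_{n+1}$) follow a rule fixed once and for all. Put $H_n=h^{(\mathfrak a)}_1\circ\dots\circ h^{(\mathfrak a)}_n$ and $T_n=H_n\circ R^{\alpha_n}\circ H_n^{-1}$. The real-analytic AbC realization of the sequence is the $d_\rho$-limit of $T_n$ in $\mathrm{Diff}^\omega_\rho(\mathbb T^2,\mu)$. **Proposition.** There are thresholds $l_n^*=l_n^*(k_0,\dots,k_n,l_0,\dots,l_{n-1})$, depending besides only on $\rho$, on $(\varepsilon_n)$ and on the rule of choice, such that: 1. $d_\rho(T_n,T_{n+1})<\varepsilon_n/2$ for every circular construction sequence as above and every $n$ with $l_n\ge l_n^*$; 2. every circular construction sequence as above with $l_n\ge l_n^*$ for all $n$ has a real-analytic AbC realization; 3. if $\{\mathcal U_n\}$ and $\{\mathcal W_n\}$ are two such sequences, each with its $l_n\geq l_n^*$ for all $n$, with realizations $S$ and $T$, and if $\mathcal U_n=\mathcal W_n$ for all $n<M$, then $$d_\rho(S,T)<\varepsilon_M .$$ -/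

import Mathlib

open MeasureTheory Filter Topology

open scoped ENNReal

namespace AnalyticAbC

/-! ### The torus, analytic functions on complex strips, and the metric `d_ρ` -/

/-- The torus `ℝ² / ℤ²`; `volume` on it is the normalised Lebesgue measure. -/
abbrev Torus : Type := UnitAddCircle × UnitAddCircle

/-- The canonical projection `ℝ² → ℝ² / ℤ²`. -/
def proj (x : ℝ × ℝ) : Torus := ((x.1 : UnitAddCircle), (x.2 : UnitAddCircle))

/-- `Ω_ρ`, the strip of half-width `ρ` around `ℝ²` in `ℂ²`. -/
def strip (ρ : ℝ) : Set (ℂ × ℂ) := {z | |z.1.im| < ρ ∧ |z.2.im| < ρ}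

/-- `ℤ²`-periodic real functions on `ℝ²`. -/
def IsPeriodic (f : ℝ × ℝ → ℝ) : Prop :=
  ∀ (x : ℝ × ℝ) (m n : ℤ), f (x.1 + m, x.2 + n) = f x

/-- `g` is holomorphic on `Ω_ρ` and extends `f`. -/
def IsHolExtension (ρ : ℝ) (f : ℝ × ℝ → ℝ) (g : ℂ × ℂ → ℂ) : Prop :=
  DifferentiableOn ℂ g (strip ρ) ∧ ∀ x : ℝ × ℝ, g ((x.1 : ℂ), (x.2 : ℂ)) = (f x : ℂ)

/-- `‖f‖_ρ`, the supremum over `Ω_ρ` of the modulus of the holomorphic extension of `f`.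
On `Ω_ρ`, `ρ > 0`, the extension is unique, so the infimum is over at most one value; it is `∞` when
there is no extension or when the extension is unbounded. -/
noncomputable def stripNorm (ρ : ℝ) (f : ℝ × ℝ → ℝ) : ℝ≥0∞ :=
  ⨅ (g : ℂ × ℂ → ℂ) (_ : IsHolExtension ρ f g), ⨆ z ∈ strip ρ, ‖g z‖ₑ

/-- `C^ω_ρ(𝕋²)`: periodic functions with a bounded holomorphic extension to `Ω_ρ`
(they are real-analytic, being restrictions of holomorphic functions). -/
def MemCOmega (ρ : ℝ) (f : ℝ × ℝ → ℝ) : Prop :=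
  IsPeriodic f ∧ stripNorm ρ f < ∞

/-- `x ↦ x + u x` is a lift of `f` to `ℝ²`, where `u` is continuous and `ℤ²`-periodic. Such a `u` is
determined by `f` up to adding an element of `ℤ²`. -/
structure IsDisplacement (f : Torus → Torus) (u : ℝ × ℝ → ℝ × ℝ) : Prop where
  continuous : Continuous u
  periodic_fst : IsPeriodic fun x => (u x).1
  periodic_snd : IsPeriodic fun x => (u x).2
  lift : ∀ x : ℝ × ℝ, proj (x + u x) = f (proj x)

/-- `f` has a lift `x ↦ x + u x` with both components of `u` in `C^ω_ρ(𝕋²)`. -/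
def HasAnalyticLift (ρ : ℝ) (f : Torus → Torus) : Prop :=
  ∃ u : ℝ × ℝ → ℝ × ℝ, IsDisplacement f u ∧
    MemCOmega ρ (fun x => (u x).1) ∧ MemCOmega ρ (fun x => (u x).2)

/-- `Diff^ω_ρ(𝕋², μ)`: measure preserving bijections of the torus such that they and their inverses
have lifts `x ↦ x + u x` with `u` in `C^ω_ρ`. (Hence they are real-analytic diffeomorphisms homotopic
to the identity.) -/
structure MemDiff (ρ : ℝ) (f : Equiv.Perm Torus) : Prop where
  measurePreserving : MeasurePreserving (f : Torus → Torus) volume volume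
  lift : HasAnalyticLift ρ f
  lift_inv : HasAnalyticLift ρ (f⁻¹ : Equiv.Perm Torus)

/-- `Diff^ω_∞(𝕋², μ)`, the intersection of all `Diff^ω_n(𝕋², μ)`, `n ≥ 1`. -/
def MemDiffInf (f : Equiv.Perm Torus) : Prop :=
  ∀ n : ℕ, 0 < n → MemDiff n f

/-- `max_i inf_{n ∈ ℤ} ‖f_i - g_i + n‖_ρ`, where `x ↦ x + (f_1 x, f_2 x)` is a lift of `f` and
`x ↦ x + (g_1 x, g_2 x)` is a lift of `g`. The value does not depend on the lifts, so the outer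
infimum only serves to pick lifts. -/
noncomputable def dTilde (ρ : ℝ) (f g : Equiv.Perm Torus) : ℝ≥0∞ :=
  ⨅ (u : ℝ × ℝ → ℝ × ℝ) (_ : IsDisplacement f u) (v : ℝ × ℝ → ℝ × ℝ) (_ : IsDisplacement g v),
    max (⨅ n : ℤ, stripNorm ρ fun x => (u x).1 - (v x).1 + n)
      (⨅ n : ℤ, stripNorm ρ fun x => (u x).2 - (v x).2 + n)

/-- The metric `d_ρ` of `Diff^ω_ρ(𝕋², μ)`. -/
noncomputable def dRho (ρ : ℝ) (f g : Equiv.Perm Torus) : ℝ≥0∞ :=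
  max (dTilde ρ f g) (dTilde ρ f⁻¹ g⁻¹)

/-- The circle action `R^t (x₁, x₂) = (x₁ + t, x₂)`. -/
noncomputable def rot (t : ℝ) : Equiv.Perm Torus :=
  Equiv.addRight (((t : UnitAddCircle), 0) : Torus)

/-! ### Circular construction sequences -/

/-- Letters: the symbols of the alphabet and two further letters `b`, `e`. -/
inductive Letter (A : Type*) : Type _
  | sym (a : A) : Letter A
  | b : Letter A
  | e : Letter A

/-- Finite words. -/
abbrev Word (A : Type*) : Type _ := List (Letter A)

/-- The pair `(p_n, q_n)`: `p_0 = 0`, `q_0 = 1`, `p_{n+1} = p_n q_n k_n l_n + 1`,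
`q_{n+1} = k_n l_n q_n²`. -/
def pq (k l : ℕ → ℕ) : ℕ → ℕ × ℕ
  | 0 => (0, 1)
  | n + 1 => ((pq k l n).1 * (pq k l n).2 * k n * l n + 1, k n * l n * (pq k l n).2 ^ 2)

/-- For coprime `p, q`, the number `j_i` with `0 ≤ j_i < q` and `p j_i ≡ i` modulo `q`. -/
def jIndex (p q i : ℕ) : ℕ := ((p : ZMod q)⁻¹ * (i : ZMod q)).val

/-- The circular operator
`C(w_0, …, w_{k-1}) = ∏_{i < q} ∏_{j < k} b^{q - j_i} w_j^{l - 1} e^{j_i}`. -/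
def circ {A : Type*} (p q l : ℕ) (ws : List (Word A)) : Word A :=
  (List.range q).flatMap fun i => ws.flatMap fun w =>
    List.replicate (q - jIndex p q i) Letter.b ++ (List.replicate (l - 1) w).flatten ++
      List.replicate (jIndex p q i) Letter.e

/-- A set of finite words, over any set of letters, is uniquely readable if `u v = p w s` with
`u, v, w` in the set forces `p` or `s` to be empty. -/
def UniquelyReadable {B : Type*} (V : Set (List B)) : Prop :=
  ∀ u ∈ V, ∀ v ∈ V, ∀ w ∈ V, ∀ p s : List B, u ++ v = p ++ w ++ s → p = [] ∨ s = []

/-- `w` can be written as `u_0 w_0 u_1 w_1 … u_r w_r u_{r+1}` with all `w_i` in `V`, the spacers `u_i`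
having total length `c`. -/
def HasParsing {A : Type*} (V : Set (Word A)) (w : Word A) (c : ℕ) : Prop :=
  ∃ (L : List (Word A × Word A)) (last : Word A), (∀ x ∈ L, x.2 ∈ V) ∧
    w = (L.flatMap fun x => x.1 ++ x.2) ++ last ∧
    (L.map fun x => x.1.length).sum + last.length = c

/-- A circular construction sequence `(W_n)` in a finite alphabet. `P n` is the set of `k_n`-tuples of
words of `W_n` from which `W_{n+1}` is formed. -/
structure CircularSequence (A : Type*) where
  /-- the alphabet -/
  alphabet : Finset A
  /-- the parameters `k_n` -/
  k : ℕ → ℕ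
  /-- the parameters `l_n` -/
  l : ℕ → ℕ
  /-- the collections of words -/
  W : ℕ → Finset (Word A)
  /-- the collections of tuples of words -/
  P : ℕ → Finset (List (Word A))
  alphabet_nonempty : alphabet.Nonempty
  mem_W_zero : ∀ w, w ∈ W 0 ↔ ∃ a ∈ alphabet, w = [Letter.sym a]
  length_of_mem_P : ∀ n, ∀ ws ∈ P n, ws.length = k n
  mem_W_of_mem_P : ∀ n, ∀ ws ∈ P n, ∀ w ∈ ws, w ∈ W n
  mem_W_succ : ∀ n w, w ∈ W (n + 1) ↔
    ∃ ws ∈ P n, circ (pq k l n).1 (pq k l n).2 (l n) ws = w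
  /-- strong unique readability -/
  readable : ∀ n, UniquelyReadable (P n : Set (List (Word A)))
  /-- every word of `W_{n+1}` contains every word of `W_n` -/
  contains : ∀ n, ∀ w' ∈ W (n + 1), ∀ w ∈ W n, w <:+: w'
  /-- the proportion of the spacers is summable -/
  spacers : ∃ δ : ℕ → ℝ, (∀ n, 0 < δ n) ∧ Summable δ ∧
    ∀ n, ∀ w ∈ W (n + 1), ∃ c : ℕ, HasParsing (W n : Set (Word A)) w c ∧
      (c : ℝ) / ((pq k l (n + 1)).2 : ℝ) < δ (n + 1)

namespace CircularSequence

variable {A : Type*}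

/-- `p_n` -/
def p (U : CircularSequence A) (n : ℕ) : ℕ := (pq U.k U.l n).1

/-- `q_n` -/
def q (U : CircularSequence A) (n : ℕ) : ℕ := (pq U.k U.l n).2

/-- `s_n`, the number of words in `W_n` -/
def s (U : CircularSequence A) (n : ℕ) : ℕ := (U.W n).card

/-- The assumptions under which circular construction sequences are realised on the torus, apart from
the growth of `l_n`: the parameters tend to infinity, `s_n` divides `k_n` and `s_{n+1}`, and each word
of `W_n` occurs exactly `k_n / s_n` times in each tuple of `P n`. -/
structure Realizable (U : CircularSequence A) : Prop where
  tendsto_k : Tendsto U.k atTop atTop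
  tendsto_l : Tendsto U.l atTop atTop
  tendsto_s : Tendsto U.s atTop atTop
  s_dvd_k : ∀ n, U.s n ∣ U.k n
  s_dvd_s : ∀ n, U.s n ∣ U.s (n + 1)
  uniform : ∀ n, ∀ ws ∈ U.P n, ∀ w ∈ U.W n,
    {t : ℕ | ws[t]? = some w}.ncard = U.k n / U.s n

open Classical in
/-- The tuple in `P n` from which the word `v` of `W_{n+1}` is formed. -/
noncomputable def tuple (U : CircularSequence A) (n : ℕ) (v : Word A) : List (Word A) :=
  if h : ∃ ws ∈ U.P n, circ (U.p n) (U.q n) (U.l n) ws = v then h.choose else []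

end CircularSequence

/-! ### Partition permutations and their approximation by diffeomorphisms -/

/-- The rectangle `[i/a, (i+1)/a) × [j/s, (j+1)/s)` in the torus. -/
def rect (a s i j : ℕ) : Set Torus :=
  proj '' (Set.Ico ((i : ℝ) / a) (((i : ℝ) + 1) / a) ×ˢ Set.Ico ((j : ℝ) / s) (((j : ℝ) + 1) / s))

/-- A permutation `τ` of the `k × s` rectangles of size `1/(kq) × 1/s` which make up
`[0, 1/q) × 𝕋` is extended to all rectangles of this size so as to commute with `R^{1/q}`. The map `h`
`ε`-approximates `τ` if, off a set of measure less than `ε`, it sends each rectangle into its image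
under `τ`. -/
def Approximates (ε : ℝ) (k q s : ℕ) (h : Torus → Torus) (τ : Equiv.Perm (Fin k × Fin s)) : Prop :=
  ∃ L : Set Torus, MeasurableSet L ∧ 1 - ε < volume.real L ∧
    ∀ (c : Fin q) (t : Fin k) (i : Fin s), ∀ x ∈ L ∩ rect (k * q) s (t + c * k) i,
      h x ∈ rect (k * q) s ((τ (t, i)).1 + c * k) (τ (t, i)).2

/-- `τ` sends the rectangle with indices `(t, i)` of the grid of `k` columns and `s'` rows in
`[0, 1/q) × 𝕋` into the strip `[0, 1/q) × [j/s, (j+1)/s)`, where `j = J i t`. -/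
def FollowsCode (k s s' : ℕ) (J : ℕ → ℕ → ℕ) (τ : Equiv.Perm (Fin k × Fin s')) : Prop :=
  ∀ (t : Fin k) (i : Fin s'),
    Set.Ico (((τ (t, i)).2 : ℝ) / s') ((((τ (t, i)).2 : ℝ) + 1) / s') ⊆
      Set.Ico ((J i t : ℝ) / s) (((J i t : ℝ) + 1) / s)

/-! ### The real-analytic AbC construction -/

/-- The free choices of the construction, made once and for all: the order in which a finite set of
words is listed, the permutation of rectangles that realises given tuples, and the entire
diffeomorphism commuting with `R^{1/q}` that approximates a given permutation at step `n`. Solvability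
of these problems is not presupposed: a choice only has to be a solution when there is one. -/
structure Choices (A : Type*) (ε : ℕ → ℝ) where
  /-- a listing of a finite set of words -/
  enum : Finset (Word A) → List (Word A)
  enum_nodup : ∀ V, (enum V).Nodup
  mem_enum : ∀ V w, w ∈ enum V ↔ w ∈ V
  /-- the chosen permutation of rectangles -/
  perm : (k s s' : ℕ) → (ℕ → ℕ → ℕ) → Equiv.Perm (Fin k × Fin s')
  perm_spec : ∀ k s s' J, (∃ τ, FollowsCode k s s' J τ) → FollowsCode k s s' J (perm k s s' J)
  /-- the chosen diffeomorphism -/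
  diffeo : (n k q s : ℕ) → Equiv.Perm (Fin k × Fin s) → Equiv.Perm Torus
  diffeo_mem : ∀ n k q s τ, MemDiffInf (diffeo n k q s τ)
  diffeo_comm : ∀ (n k q s : ℕ) (τ : Equiv.Perm (Fin k × Fin s)), Commute (diffeo n k q s τ) (rot (1 / (q : ℝ)))
  diffeo_spec : ∀ (n k q s : ℕ) (τ : Equiv.Perm (Fin k × Fin s)),
    (∃ h : Equiv.Perm Torus, MemDiffInf h ∧ Commute h (rot (1 / (q : ℝ))) ∧
      Approximates (ε n) k q s h τ) →
    Approximates (ε n) k q s (diffeo n k q s τ) τ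

theorem memDiffInf_one : MemDiffInf 1 := by
  have hz : ∀ ρ : ℝ, MemCOmega ρ (fun _ => (0 : ℝ)) := by
    intro ρ
    refine ⟨fun _ _ _ => rfl, ?_⟩
    refine lt_of_le_of_lt (iInf₂_le (fun _ => 0) ⟨differentiableOn_const _, fun x => by simp⟩) ?_
    simp
  have hl : ∀ ρ : ℝ, HasAnalyticLift ρ (1 : Equiv.Perm Torus) := by
    intro ρ
    exact ⟨fun _ => 0, ⟨continuous_const, fun _ _ _ => rfl, fun _ _ _ => rfl,
      fun x => by simp⟩, hz ρ, hz ρ⟩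
  intro n _
  exact ⟨MeasurePreserving.id _, hl n, by simpa using hl n⟩

/-- Choices as above always exist. -/
instance {A : Type*} {ε : ℕ → ℝ} : Nonempty (Choices A ε) := by
  classical
  exact ⟨{
    enum := Finset.toList
    enum_nodup := fun V => V.nodup_toList
    mem_enum := fun V w => Finset.mem_toList
    perm := fun k s s' J => if h : ∃ τ, FollowsCode k s s' J τ then h.choose else 1
    perm_spec := fun k s s' J h => by
      simp only [dif_pos h]
      exact h.choose_spec
    diffeo := fun n k q s τ =>
      if h : ∃ h : Equiv.Perm Torus, MemDiffInf h ∧ Commute h (rot (1 / (q : ℝ))) ∧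
        Approximates (ε n) k q s h τ then h.choose else 1
    diffeo_mem := fun n k q s τ => by
      split_ifs with h
      · exact h.choose_spec.1
      · exact memDiffInf_one
    diffeo_comm := fun n k q s τ => by
      split_ifs with h
      · exact h.choose_spec.2.1
      · exact Commute.one_left _
    diffeo_spec := fun n k q s τ h => by
      simp only [dif_pos h]
      exact h.choose_spec.2.2 }⟩

namespace Choices

variable {A : Type*} {ε : ℕ → ℝ}

open Classical in
/-- The number, in the listing of `W_n`, of the `t`-th word in the tuple that forms the `i`-th word of
`W_{n+1}`. -/
noncomputable def code (C : Choices A ε) (U : CircularSequence A) (n i t : ℕ) : ℕ :=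
  (C.enum (U.W n)).idxOf ((U.tuple n ((C.enum (U.W (n + 1))).getD i [])).getD t [])

/-- The partition permutation `h_{n+1}`. -/
noncomputable def partitionPerm (C : Choices A ε) (U : CircularSequence A) (n : ℕ) :
    Equiv.Perm (Fin (U.k n) × Fin (U.s (n + 1))) :=
  C.perm (U.k n) (U.s n) (U.s (n + 1)) (C.code U n)

/-- The diffeomorphism approximating `h_{n+1}` up to `ε_{n+1}`. -/
noncomputable def h (C : Choices A ε) (U : CircularSequence A) (n : ℕ) : Equiv.Perm Torus :=
  C.diffeo (n + 1) (U.k n) (U.q n) (U.s (n + 1)) (C.partitionPerm U n)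

/-- `H_n`, the composition of the first `n` diffeomorphisms: `H_{n+1} = H_n ∘ h_{n+1}`. -/
noncomputable def H (C : Choices A ε) (U : CircularSequence A) : ℕ → Equiv.Perm Torus
  | 0 => 1
  | n + 1 => H C U n * C.h U n

/-- `T_n = H_n ∘ R^{α_n} ∘ H_n⁻¹` with `α_n = p_n / q_n`. -/
noncomputable def T (C : Choices A ε) (U : CircularSequence A) (n : ℕ) : Equiv.Perm Torus :=
  C.H U n * rot ((U.p n : ℝ) / (U.q n : ℝ)) * (C.H U n)⁻¹

/-- `S` is the real-analytic AbC realization of `U`: the limit of `T_n` in `Diff^ω_ρ(𝕋², μ)`. -/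
def IsRealization (C : Choices A ε) (ρ : ℝ) (U : CircularSequence A) (S : Equiv.Perm Torus) : Prop :=
  MemDiff ρ S ∧ Tendsto (fun n => dRho ρ (C.T U n) S) atTop (𝓝 0)

end Choices

/-- A lower bound for each `l_n` in terms of `k_0, …, k_n` and `l_0, …, l_{n-1}`. -/
abbrev Threshold : Type := (n : ℕ) → (Fin (n + 1) → ℕ) → (Fin n → ℕ) → ℕ

/-- `l_n` is at least the threshold. -/
def Threshold.BoundAt {A : Type*} (lStar : Threshold) (U : CircularSequence A) (n : ℕ) : Prop :=
  lStar n (fun i => U.k i) (fun i => U.l i) ≤ U.l n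

end AnalyticAbC

open AnalyticAbC

namespace AnalyticAbC

/-! ### Holomorphic extensions to strips -/

/-! Since $h_{n+1}$ commutes with $R^{1/q_n}$, it commutes with $R^{\alpha_n}$, so $T_n = H_{n+1}
R^{\alpha_n} H_{n+1}^{-1}$ (`Choices.T_eq_conj_succ`). Thus $T_n$ and $T_{n+1}$ are conjugates, by
the same map, of rotations whose angles differ by $1/(k_n l_n q_n^2) \le 1/l_n$. A conjugate of a
rotation by a fixed entire diffeomorphism is Lipschitz in the angle, by a Cauchy estimate on a wider
strip (`exists_dRho_conj_rot_le`). The constant depends on $H_{n+1}$, but for given $k_0,\dots,k_n$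
and $l_0,\dots,l_{n-1}$ only finitely many $H_{n+1}$ occur, because $s_0 \mid k_0$ and $s_{n+1} \le
s_n^{k_n}$ bound the number of rectangles (`Choices.finite_setOf_H`). Hence one threshold for $l_n$
serves all sequences (`Choices.exists_threshold`).

Realizations exist because summable consecutive distances force convergence
(`exists_memDiff_limit`): extensions converge uniformly on the strip, and the limits of $T_n$ and
$T_n^{-1}$ are inverse to each other.

For closeness, the collections $\mathcal W_0,\dots,\mathcal W_n$ determine $T_n$ (`Choices.T_eq`):
word lengths and counts of alphabet letters give back $k_i$ and $l_i$, and injectivity of the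
circular operator gives back the tuples. So the two sequences share $T_{M-1}$, and both realizations
are close to it. As the step from $T_{M-1}$ to $T_M$ has to be paid for out of $\varepsilon_M$, the
thresholds are chosen for the smaller bounds $\varepsilon_{n+1}/8$ instead of $\varepsilon_n/2$. -/

theorem strip_mono {ρ σ : ℝ} (h : ρ ≤ σ) : strip ρ ⊆ strip σ :=
  fun _ hz => ⟨hz.1.trans_le h, hz.2.trans_le h⟩

theorem isOpen_strip (ρ : ℝ) : IsOpen (strip ρ) := by
  unfold strip
  exact (isOpen_lt (Complex.continuous_im.comp continuous_fst).abs continuous_const).inter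
    (isOpen_lt (Complex.continuous_im.comp continuous_snd).abs continuous_const)

theorem real_mem_strip {ρ : ℝ} (hρ : 0 < ρ) (x : ℝ × ℝ) : ((x.1 : ℂ), (x.2 : ℂ)) ∈ strip ρ := by
  simp [strip, hρ]

theorem add_mem_strip {ρ B : ℝ} {z w : ℂ × ℂ} (hz : z ∈ strip ρ) (h₁ : |w.1.im| ≤ B)
    (h₂ : |w.2.im| ≤ B) : z + w ∈ strip (ρ + B) := by
  constructor
  · simpa using (abs_add_le _ _).trans_lt (add_lt_add_of_lt_of_le hz.1 h₁)
  · simpa using (abs_add_le _ _).trans_lt (add_lt_add_of_lt_of_le hz.2 h₂)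

theorem ball_subset_strip {ρ r : ℝ} {z : ℂ × ℂ} (hz : z ∈ strip ρ) :
    Metric.ball z r ⊆ strip (ρ + r) := by
  intro w hw
  rw [Metric.mem_ball, dist_eq_norm] at hw
  have h₁ := (Complex.abs_im_le_norm (w - z).1).trans ((norm_fst_le _).trans hw.le)
  have h₂ := (Complex.abs_im_le_norm (w - z).2).trans ((norm_snd_le _).trans hw.le)
  simpa using add_mem_strip hz h₁ h₂

namespace IsHolExtension

variable {ρ σ : ℝ} {f f' : ℝ × ℝ → ℝ} {g g' : ℂ × ℂ → ℂ}

theorem mono (h : IsHolExtension σ f g) (hρ : ρ ≤ σ) : IsHolExtension ρ f g :=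
  ⟨h.1.mono (strip_mono hρ), h.2⟩

theorem add (h : IsHolExtension ρ f g) (h' : IsHolExtension ρ f' g') :
    IsHolExtension ρ (fun x => f x + f' x) (fun z => g z + g' z) :=
  ⟨h.1.add h'.1, fun x => by simp [h.2, h'.2]⟩

theorem sub (h : IsHolExtension ρ f g) (h' : IsHolExtension ρ f' g') :
    IsHolExtension ρ (fun x => f x - f' x) (fun z => g z - g' z) :=
  ⟨h.1.sub h'.1, fun x => by simp [h.2, h'.2]⟩

theorem neg (h : IsHolExtension ρ f g) : IsHolExtension ρ (fun x => -f x) (fun z => -g z) :=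
  ⟨h.1.neg, fun x => by simp [h.2]⟩

theorem const (ρ c : ℝ) : IsHolExtension ρ (fun _ => c) (fun _ => (c : ℂ)) :=
  ⟨differentiableOn_const _, fun _ => rfl⟩

end IsHolExtension

theorem stripNorm_le {ρ c : ℝ} {f : ℝ × ℝ → ℝ} {g : ℂ × ℂ → ℂ} (h : IsHolExtension ρ f g)
    (hc : ∀ z ∈ strip ρ, ‖g z‖ ≤ c) : stripNorm ρ f ≤ ENNReal.ofReal c := by
  refine (iInf₂_le g h).trans (iSup₂_le fun z hz => ?_)
  rw [← ofReal_norm]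
  exact ENNReal.ofReal_le_ofReal (hc z hz)

theorem exists_extension_of_stripNorm_lt {ρ c : ℝ} {f : ℝ × ℝ → ℝ}
    (h : stripNorm ρ f < ENNReal.ofReal c) :
    ∃ g, IsHolExtension ρ f g ∧ ∀ z ∈ strip ρ, ‖g z‖ ≤ c := by
  simp only [stripNorm, iInf_lt_iff] at h
  obtain ⟨g, hg, hlt⟩ := h
  refine ⟨g, hg, fun z hz => ?_⟩
  have := (le_iSup₂ (f := fun z (_ : z ∈ strip ρ) => ‖g z‖ₑ) z hz).trans_lt hlt
  rw [← ofReal_norm] at this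
  exact ((ENNReal.ofReal_lt_ofReal_iff_of_nonneg (norm_nonneg _)).1 this).le

theorem exists_extension_of_stripNorm_lt_top {ρ : ℝ} {f : ℝ × ℝ → ℝ} (h : stripNorm ρ f < ∞) :
    ∃ g B, 0 ≤ B ∧ IsHolExtension ρ f g ∧ ∀ z ∈ strip ρ, ‖g z‖ ≤ B := by
  have : stripNorm ρ f < ENNReal.ofReal ((stripNorm ρ f).toReal + 1) := by
    rw [ENNReal.ofReal_add ENNReal.toReal_nonneg zero_le_one, ENNReal.ofReal_toReal h.ne]
    exact ENNReal.lt_add_right h.ne (by simp)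
  obtain ⟨g, hg, hb⟩ := exists_extension_of_stripNorm_lt this
  exact ⟨g, _, by positivity, hg, hb⟩

theorem stripNorm_add_le (ρ : ℝ) (f g : ℝ × ℝ → ℝ) :
    stripNorm ρ (fun x => f x + g x) ≤ stripNorm ρ f + stripNorm ρ g := by
  conv_rhs => unfold stripNorm
  simp only [ENNReal.iInf_add, ENNReal.add_iInf]
  refine le_iInf fun F => le_iInf fun hF => le_iInf fun G => le_iInf fun hG => ?_
  refine (iInf₂_le _ (hG.add hF)).trans (iSup₂_le fun z hz => ?_)
  exact (enorm_add_le _ _).trans (add_le_add (le_iSup₂ (f := fun z (_ : z ∈ strip ρ) => ‖G z‖ₑ) z hz)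
    (le_iSup₂ (f := fun z (_ : z ∈ strip ρ) => ‖F z‖ₑ) z hz))

theorem stripNorm_neg (ρ : ℝ) (f : ℝ × ℝ → ℝ) :
    stripNorm ρ (fun x => -f x) ≤ stripNorm ρ f :=
  le_iInf₂ fun g hg => (iInf₂_le _ hg.neg).trans (by simp)

/-- A bounded holomorphic function on a strip is Lipschitz on smaller strips. -/
theorem norm_sub_le_of_bounded_on_strip {ρ M : ℝ} {g : ℂ × ℂ → ℂ}
    (hg : DifferentiableOn ℂ g (strip (ρ + 1))) (hM : ∀ z ∈ strip (ρ + 1), ‖g z‖ ≤ M)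
    {z w : ℂ × ℂ} (hz : z ∈ strip ρ) (hzw : ‖w - z‖ < 1) : ‖g w - g z‖ ≤ 2 * M * ‖w - z‖ := by
  have hsub : Metric.ball z 1 ⊆ strip (ρ + 1) := ball_subset_strip hz
  -- Schwarz lemma on the unit ball about `z`, whose image lies within `2 * M` of `g z`.
  have := Complex.dist_le_div_mul_dist_of_mapsTo_ball (R₂ := 2 * M) (hg.mono hsub) (z := w)
    (fun y hy => ?_) (by rwa [Metric.mem_ball, dist_eq_norm])
  · simpa [dist_eq_norm] using this
  · rw [Metric.mem_closedBall, dist_eq_norm]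
    have h₁ := hM y (hsub hy)
    have h₂ := hM z (hsub (Metric.mem_ball_self one_pos))
    linarith [norm_sub_le (g y) (g z)]

/-! ### Displacements -/

theorem proj_eq_proj_iff {x y : ℝ × ℝ} :
    proj x = proj y ↔ ∃ m n : ℤ, x = (y.1 + m, y.2 + n) := by
  have key : ∀ a b : ℝ, ((a : UnitAddCircle) = (b : UnitAddCircle)) ↔ ∃ m : ℤ, a = b + m := by
    intro a b
    rw [eq_comm, QuotientAddGroup.eq, AddSubgroup.mem_zmultiples_iff]
    constructor
    · rintro ⟨m, hm⟩
      exact ⟨m, by simp at hm; linarith⟩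
    · rintro ⟨m, rfl⟩
      exact ⟨m, by simp⟩
  simp only [proj, key, Prod.ext_iff]
  constructor
  · rintro ⟨⟨m, hm⟩, n, hn⟩
    exact ⟨m, n, hm, hn⟩
  · rintro ⟨m, n, hm, hn⟩
    exact ⟨⟨m, hm⟩, n, hn⟩

theorem proj_add (x y : ℝ × ℝ) : proj (x + y) = proj x + proj y := rfl

theorem continuous_proj : Continuous proj := by
  unfold proj
  exact ((AddCircle.continuous_mk' 1).comp continuous_fst).prodMk
    ((AddCircle.continuous_mk' 1).comp continuous_snd)

theorem proj_surjective : Function.Surjective proj := by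
  rintro ⟨a, b⟩
  obtain ⟨x, rfl⟩ := QuotientAddGroup.mk_surjective a
  obtain ⟨y, rfl⟩ := QuotientAddGroup.mk_surjective b
  exact ⟨(x, y), rfl⟩

/-- The plane is connected and the integers are discrete in `ℝ`. -/
theorem exists_int_of_continuous {f : ℝ × ℝ → ℝ} (hf : Continuous f)
    (h : ∀ x, ∃ m : ℤ, f x = m) : ∃ m : ℤ, ∀ x, f x = m := by
  have hd : IsDiscrete (Set.range ((↑) : ℤ → ℝ)) := by
    rw [isDiscrete_iff_discreteTopology]
    exact Int.isClosedEmbedding_coe_real.isEmbedding.toHomeomorph.symm.isEmbedding.discreteTopology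
  obtain ⟨m, hm⟩ := h 0
  refine ⟨m, fun x => ?_⟩
  rw [← hm]
  refine isPreconnected_univ.constant_of_mapsTo hd hf.continuousOn (fun y _ => ?_) trivial trivial
  obtain ⟨k, hk⟩ := h y
  exact ⟨k, hk.symm⟩

namespace IsDisplacement

variable {f g : Torus → Torus} {u v : ℝ × ℝ → ℝ × ℝ}

theorem exists_int (hu : IsDisplacement f u) (hv : IsDisplacement f v) :
    ∃ m n : ℤ, ∀ x, u x = ((v x).1 + m, (v x).2 + n) := by
  have h : ∀ x, ∃ m n : ℤ, u x = ((v x).1 + m, (v x).2 + n) := by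
    intro x
    obtain ⟨m, n, h⟩ := proj_eq_proj_iff.1 ((hu.lift x).trans (hv.lift x).symm)
    refine ⟨m, n, ?_⟩
    simp only [Prod.ext_iff, Prod.fst_add, Prod.snd_add] at h ⊢
    constructor <;> linarith
  have cu := hu.continuous
  have cv := hv.continuous
  obtain ⟨m, hm⟩ := exists_int_of_continuous (f := fun x => (u x).1 - (v x).1) (by fun_prop)
    fun x => by
      obtain ⟨m, n, h⟩ := h x
      exact ⟨m, by simp [h]⟩
  obtain ⟨n, hn⟩ := exists_int_of_continuous (f := fun x => (u x).2 - (v x).2) (by fun_prop)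
    fun x => by
      obtain ⟨m, n, h⟩ := h x
      exact ⟨n, by simp [h]⟩
  refine ⟨m, n, fun x => Prod.ext ?_ ?_⟩
  · simp only [← hm x]; ring
  · simp only [← hn x]; ring

theorem periodic (hu : IsDisplacement f u) (x : ℝ × ℝ) (m n : ℤ) :
    u (x.1 + m, x.2 + n) = u x :=
  Prod.ext (hu.periodic_fst x m n) (hu.periodic_snd x m n)

theorem add_int (hu : IsDisplacement f u) (m n : ℤ) :
    IsDisplacement f (fun x => ((u x).1 + m, (u x).2 + n)) where
  continuous := by
    have := hu.continuous
    fun_prop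
  periodic_fst x a b := by simp [hu.periodic]
  periodic_snd x a b := by simp [hu.periodic]
  lift x := by
    rw [← hu.lift x, proj_eq_proj_iff]
    exact ⟨m, n, Prod.ext (by simp [add_assoc]) (by simp [add_assoc])⟩

theorem comp (hu : IsDisplacement f u) (hv : IsDisplacement g v) :
    IsDisplacement (f ∘ g) (fun x => v x + u (x + v x)) := by
  have hp : ∀ (x : ℝ × ℝ) (m n : ℤ),
      (fun x => v x + u (x + v x)) (x.1 + m, x.2 + n) = v x + u (x + v x) := by
    intro x m n
    simp only [hv.periodic]
    rw [← hu.periodic (x + v x) m n]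
    congr 2
    ext <;> simp <;> ring
  refine ⟨?_, fun x m n => congrArg Prod.fst (hp x m n), fun x m n => congrArg Prod.snd (hp x m n),
    fun x => ?_⟩
  · have := hu.continuous
    have := hv.continuous
    fun_prop
  · rw [← add_assoc, hu.lift, hv.lift, Function.comp_apply]

theorem rot (t : ℝ) : IsDisplacement (rot t) (fun _ => (t, 0)) :=
  ⟨continuous_const, fun _ _ _ => rfl, fun _ _ _ => rfl, fun _ => rfl⟩

end IsDisplacement

/-! ### The metric -/

theorem dTilde_le_of_displacement {ρ : ℝ} {f g : Equiv.Perm Torus} {u v : ℝ × ℝ → ℝ × ℝ}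
    (hu : IsDisplacement f u) (hv : IsDisplacement g v) {c : ℝ≥0∞}
    (h₁ : stripNorm ρ (fun x => (u x).1 - (v x).1) ≤ c)
    (h₂ : stripNorm ρ (fun x => (u x).2 - (v x).2) ≤ c) : dTilde ρ f g ≤ c := by
  refine (iInf₂_le u hu).trans ((iInf₂_le v hv).trans (max_le ?_ ?_))
  · exact (iInf_le _ 0).trans (by simpa using h₁)
  · exact (iInf_le _ 0).trans (by simpa using h₂)

theorem dTilde_comm_le (ρ : ℝ) (f g : Equiv.Perm Torus) : dTilde ρ f g ≤ dTilde ρ g f := by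
  refine le_iInf₂ fun v hv => le_iInf₂ fun u hu =>
    (iInf₂_le u hu).trans ((iInf₂_le v hv).trans (max_le_max ?_ ?_)) <;>
  · refine le_iInf fun n => (iInf_le _ (-n)).trans ?_
    refine le_trans (le_of_eq ?_) (stripNorm_neg ρ _)
    congr 1
    ext x
    push_cast
    ring

/-- The two middle functions stand for two lifts of one map; the integer `k` between them is
absorbed by the infimum. -/
theorem iInf_stripNorm_triangle (ρ : ℝ) {a b c d : ℝ × ℝ → ℝ} (k : ℤ) (h : ∀ x, b x = c x + k) :
    (⨅ n : ℤ, stripNorm ρ fun x => a x - d x + n) ≤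
      (⨅ n : ℤ, stripNorm ρ fun x => a x - b x + n) +
        ⨅ n : ℤ, stripNorm ρ fun x => c x - d x + n := by
  simp only [ENNReal.iInf_add, ENNReal.add_iInf]
  refine le_iInf fun m => le_iInf fun n => (iInf_le _ (n + m - k)).trans ?_
  refine le_trans (le_of_eq ?_) (stripNorm_add_le ρ _ _)
  congr 1
  ext x
  rw [h]
  push_cast
  ring

theorem dTilde_triangle (ρ : ℝ) (f g h : Equiv.Perm Torus) :
    dTilde ρ f h ≤ dTilde ρ f g + dTilde ρ g h := by
  conv_rhs => unfold dTilde
  simp only [ENNReal.iInf_add, ENNReal.add_iInf]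
  refine le_iInf₂ fun v hv => le_iInf₂ fun w hw => le_iInf₂ fun u hu => le_iInf₂ fun v' hv' => ?_
  obtain ⟨m, n, h⟩ := hv'.exists_int hv
  refine (iInf₂_le u hu).trans ((iInf₂_le w hw).trans (max_le ?_ ?_))
  · exact (iInf_stripNorm_triangle ρ m fun x => by simp [h]).trans
      (add_le_add (le_max_left _ _) (le_max_left _ _))
  · exact (iInf_stripNorm_triangle ρ n fun x => by simp [h]).trans
      (add_le_add (le_max_right _ _) (le_max_right _ _))

theorem dRho_comm (ρ : ℝ) (f g : Equiv.Perm Torus) : dRho ρ f g = dRho ρ g f :=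
  le_antisymm (max_le_max (dTilde_comm_le _ _ _) (dTilde_comm_le _ _ _))
    (max_le_max (dTilde_comm_le _ _ _) (dTilde_comm_le _ _ _))

theorem dRho_triangle (ρ : ℝ) (f g h : Equiv.Perm Torus) :
    dRho ρ f h ≤ dRho ρ f g + dRho ρ g h :=
  max_le ((dTilde_triangle ρ f g h).trans (add_le_add (le_max_left _ _) (le_max_left _ _)))
    ((dTilde_triangle ρ f⁻¹ g⁻¹ h⁻¹).trans (add_le_add (le_max_right _ _) (le_max_right _ _)))

/-! ### The group of entire diffeomorphisms -/

theorem HasAnalyticLift.mono {ρ σ : ℝ} {f : Torus → Torus} (h : HasAnalyticLift σ f)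
    (hρ : ρ ≤ σ) : HasAnalyticLift ρ f := by
  have key : ∀ f, MemCOmega σ f → MemCOmega ρ f := by
    rintro f ⟨hp, hf⟩
    obtain ⟨g, B, _, hg, hB⟩ := exists_extension_of_stripNorm_lt_top hf
    exact ⟨hp, (stripNorm_le (hg.mono hρ) fun z hz => hB z (strip_mono hρ hz)).trans_lt
      ENNReal.ofReal_lt_top⟩
  obtain ⟨u, hu, h₁, h₂⟩ := h
  exact ⟨u, hu, key _ h₁, key _ h₂⟩

/-- The data of an analytic lift: the displacement, extensions of its components and a bound. -/
theorem HasAnalyticLift.exists_bound {ρ : ℝ} {f : Torus → Torus} (h : HasAnalyticLift ρ f) :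
    ∃ u U V B, 0 ≤ B ∧ IsDisplacement f u ∧ IsHolExtension ρ (fun x => (u x).1) U ∧
      IsHolExtension ρ (fun x => (u x).2) V ∧ ∀ z ∈ strip ρ, ‖U z‖ ≤ B ∧ ‖V z‖ ≤ B := by
  obtain ⟨u, hu, ⟨_, h₁⟩, ⟨_, h₂⟩⟩ := h
  obtain ⟨U, B, hB, hU, hUB⟩ := exists_extension_of_stripNorm_lt_top h₁
  obtain ⟨V, B', hB', hV, hVB⟩ := exists_extension_of_stripNorm_lt_top h₂
  exact ⟨u, U, V, max B B', le_max_of_le_left hB, hu, hU, hV, fun z hz =>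
    ⟨(hUB z hz).trans (le_max_left _ _), (hVB z hz).trans (le_max_right _ _)⟩⟩

theorem HasAnalyticLift.of_bound {ρ B : ℝ} {f : Torus → Torus} {u : ℝ × ℝ → ℝ × ℝ}
    {U V : ℂ × ℂ → ℂ} (hu : IsDisplacement f u) (hU : IsHolExtension ρ (fun x => (u x).1) U)
    (hV : IsHolExtension ρ (fun x => (u x).2) V) (hUB : ∀ z ∈ strip ρ, ‖U z‖ ≤ B)
    (hVB : ∀ z ∈ strip ρ, ‖V z‖ ≤ B) : HasAnalyticLift ρ f :=
  ⟨u, hu, ⟨hu.periodic_fst, (stripNorm_le hU hUB).trans_lt ENNReal.ofReal_lt_top⟩,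
    ⟨hu.periodic_snd, (stripNorm_le hV hVB).trans_lt ENNReal.ofReal_lt_top⟩⟩

section Composition

variable {ρ B : ℝ} {v : ℝ × ℝ → ℝ × ℝ} {U V : ℂ × ℂ → ℂ}

theorem displaced_mem_strip (hB : ∀ z ∈ strip ρ, ‖U z‖ ≤ B ∧ ‖V z‖ ≤ B) {z : ℂ × ℂ}
    (hz : z ∈ strip ρ) (a : ℝ) : z + (U z, V z) + ((a : ℂ), 0) ∈ strip (ρ + B) := by
  have := add_mem_strip (w := (U z + a, V z)) hz
    (by simpa using (Complex.abs_im_le_norm _).trans (hB z hz).1)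
    ((Complex.abs_im_le_norm _).trans (hB z hz).2)
  convert this using 1
  ext <;> simp [add_assoc]

theorem IsHolExtension.comp_displaced {f : ℝ × ℝ → ℝ} {F : ℂ × ℂ → ℂ}
    (hU : IsHolExtension ρ (fun x => (v x).1) U) (hV : IsHolExtension ρ (fun x => (v x).2) V)
    (hB : ∀ z ∈ strip ρ, ‖U z‖ ≤ B ∧ ‖V z‖ ≤ B) (hF : IsHolExtension (ρ + B) f F) (a : ℝ) :
    IsHolExtension ρ (fun x => f (x + v x + (a, 0)))
      (fun z => F (z + (U z, V z) + ((a : ℂ), 0))) := by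
  refine ⟨hF.1.comp ?_ fun z hz => displaced_mem_strip hB hz a, fun x => ?_⟩
  · exact (differentiableOn_id.add (hU.1.prodMk hV.1)).add (differentiableOn_const _)
  · beta_reduce
    rw [← hF.2, hU.2, hV.2]
    congr 1
    ext <;> simp

end Composition

/-- The inner displacement moves points of the strip by up to `B` in imaginary direction, so the
outer map has to be analytic on a wider strip; hence the hypothesis for all widths. -/
theorem HasAnalyticLift.comp {ρ : ℝ} {f g : Torus → Torus} (hf : ∀ σ, HasAnalyticLift σ f)
    (hg : HasAnalyticLift ρ g) : HasAnalyticLift ρ (f ∘ g) := by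
  obtain ⟨v, U, V, B, hB, hv, hU, hV, hUV⟩ := hg.exists_bound
  obtain ⟨u, F, G, B', hB', hu, hF, hG, hFG⟩ := (hf (ρ + B)).exists_bound
  have hz : ((0 : ℝ), (0 : ℝ)) = 0 := rfl
  refine .of_bound (B := B + B') (hu.comp hv)
    (U := fun z => U z + F (z + (U z, V z) + (((0 : ℝ) : ℂ), 0)))
    (V := fun z => V z + G (z + (U z, V z) + (((0 : ℝ) : ℂ), 0))) ?_ ?_ ?_ ?_
  · simpa [hz] using hU.add (hU.comp_displaced hV hUV hF 0)
  · simpa [hz] using hV.add (hU.comp_displaced hV hUV hG 0)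
  · exact fun z hz => norm_add_le_of_le (hUV z hz).1 (hFG _ (displaced_mem_strip hUV hz 0)).1
  · exact fun z hz => norm_add_le_of_le (hUV z hz).2 (hFG _ (displaced_mem_strip hUV hz 0)).2

theorem hasAnalyticLift_rot (ρ t : ℝ) : HasAnalyticLift ρ (rot t) :=
  .of_bound (B := |t|) (.rot t) (.const ρ t) (.const ρ 0) (by simp) (by simp)

theorem MemDiffInf.hasAnalyticLift {f : Equiv.Perm Torus} (h : MemDiffInf f) (ρ : ℝ) :
    HasAnalyticLift ρ f := by
  obtain ⟨n, hn⟩ := exists_nat_gt (max ρ 0)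
  exact ((h n (by exact_mod_cast (le_max_right ρ 0).trans_lt hn)).lift).mono
    ((le_max_left _ _).trans hn.le)

theorem memDiffInf_iff {f : Equiv.Perm Torus} :
    MemDiffInf f ↔ MeasurePreserving (f : Torus → Torus) volume volume ∧
      (∀ ρ, HasAnalyticLift ρ f) ∧ ∀ ρ, HasAnalyticLift ρ (f⁻¹ : Equiv.Perm Torus) := by
  refine ⟨fun h => ⟨(h 1 one_pos).1, h.hasAnalyticLift, fun ρ => ?_⟩,
    fun h n _ => ⟨h.1, h.2.1 n, h.2.2 n⟩⟩
  obtain ⟨n, hn⟩ := exists_nat_gt (max ρ 0)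
  exact ((h n (by exact_mod_cast (le_max_right ρ 0).trans_lt hn)).lift_inv).mono
    ((le_max_left _ _).trans hn.le)

theorem MemDiffInf.memDiff {f : Equiv.Perm Torus} (h : MemDiffInf f) (ρ : ℝ) : MemDiff ρ f :=
  ⟨(memDiffInf_iff.1 h).1, (memDiffInf_iff.1 h).2.1 ρ, (memDiffInf_iff.1 h).2.2 ρ⟩

theorem MemDiffInf.mul {f g : Equiv.Perm Torus} (hf : MemDiffInf f) (hg : MemDiffInf g) :
    MemDiffInf (f * g) := by
  rw [memDiffInf_iff] at *
  refine ⟨hf.1.comp hg.1, fun ρ => HasAnalyticLift.comp (f := f) (g := g) hf.2.1 (hg.2.1 ρ), fun ρ => ?_⟩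
  rw [mul_inv_rev]
  exact HasAnalyticLift.comp (f := (g⁻¹ : Equiv.Perm Torus)) (g := (f⁻¹ : Equiv.Perm Torus)) hg.2.2 (hf.2.2 ρ)

theorem IsDisplacement.continuous_map {f : Torus → Torus} {u : ℝ × ℝ → ℝ × ℝ}
    (hu : IsDisplacement f u) : Continuous f := by
  have hq : IsOpenQuotientMap proj :=
    QuotientAddGroup.isOpenQuotientMap_mk.prodMap QuotientAddGroup.isOpenQuotientMap_mk
  rw [hq.isQuotientMap.continuous_iff]
  have : f ∘ proj = fun x => proj (x + u x) := funext fun x => (hu.lift x).symm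
  rw [this]
  exact continuous_proj.comp (continuous_id.add hu.continuous)

theorem rot_inv (t : ℝ) : (rot t)⁻¹ = rot (-t) := by
  ext x <;> simp [rot, Equiv.Perm.inv_def]

theorem rot_add (s t : ℝ) : rot (s + t) = rot s * rot t := by
  ext x <;> simp [rot, Equiv.Perm.mul_def]; abel

theorem rot_zero : rot 0 = 1 := by
  ext x <;> simp [rot]

theorem rot_nat_mul (n : ℕ) (t : ℝ) : rot (n * t) = rot t ^ n := by
  induction n with
  | zero => simp [rot_zero]
  | succ n ih => rw [pow_succ, ← ih, ← rot_add]; push_cast; ring_nf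

theorem memDiffInf_rot (t : ℝ) : MemDiffInf (rot t) := by
  refine memDiffInf_iff.2 ⟨?_, fun ρ => hasAnalyticLift_rot ρ t, fun ρ => ?_⟩
  · exact (measurePreserving_add_right (volume : Measure UnitAddCircle) (t : UnitAddCircle)).prod
      (measurePreserving_add_right (volume : Measure UnitAddCircle) 0)
  · rw [rot_inv]
    exact hasAnalyticLift_rot ρ _

theorem MemDiffInf.inv {f : Equiv.Perm Torus} (hf : MemDiffInf f) : MemDiffInf f⁻¹ := by
  obtain ⟨hm, hl, hi⟩ := memDiffInf_iff.1 hf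
  have hm' : Measurable (f⁻¹ : Equiv.Perm Torus) := by
    obtain ⟨u, hu, -⟩ := hi 1
    exact hu.continuous_map.measurable
  exact memDiffInf_iff.2 ⟨MeasurePreserving.symm ⟨f, hm.measurable, hm'⟩ hm, hi, by simpa using hl⟩

/-- Conjugates of rotations depend in a Lipschitz way on the angle. -/
theorem exists_dRho_conj_rot_le (ρ : ℝ) {f : Equiv.Perm Torus} (hf : MemDiffInf f) :
    ∃ K, 0 ≤ K ∧ ∀ a b : ℝ, |a - b| < 1 →
      dRho ρ (f * rot a * f⁻¹) (f * rot b * f⁻¹) ≤ ENNReal.ofReal (K * |a - b|) := by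
  obtain ⟨hm, hl, hi⟩ := memDiffInf_iff.1 hf
  obtain ⟨v, U, V, B, hB, hv, hU, hV, hUV⟩ := (hi ρ).exists_bound
  -- `B` leaves room for the displacement of `f⁻¹`, and `1` for the radius in the Cauchy estimate.
  obtain ⟨u, F, G, B', hB', hu, hF, hG, hFG⟩ := (hl (ρ + B + 1)).exists_bound
  have key : ∀ a b : ℝ, |a - b| < 1 → dTilde ρ (f * rot a * f⁻¹) (f * rot b * f⁻¹) ≤
      ENNReal.ofReal ((1 + 2 * B') * |a - b|) := by
    intro a b hab
    have hd : ∀ c : ℝ, IsDisplacement (f * rot c * f⁻¹ : Equiv.Perm Torus)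
        (fun x => v x + ((c, 0) + u (x + v x + (c, 0)))) := by
      intro c
      have := (hu.comp (IsDisplacement.rot c)).comp hv
      simpa [Function.comp_assoc] using this
    have hL : ∀ F : ℂ × ℂ → ℂ, DifferentiableOn ℂ F (strip (ρ + B + 1)) →
        (∀ z ∈ strip (ρ + B + 1), ‖F z‖ ≤ B') → ∀ z ∈ strip ρ,
        ‖F (z + (U z, V z) + ((a : ℂ), 0)) - F (z + (U z, V z) + ((b : ℂ), 0))‖ ≤
          2 * B' * |a - b| := by
      intro F hF hFB z hz
      have hn : ‖z + (U z, V z) + ((a : ℂ), 0) - (z + (U z, V z) + ((b : ℂ), 0))‖ = |a - b| := by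
        rw [add_sub_add_left_eq_sub, Prod.mk_sub_mk, ← Complex.ofReal_sub, Prod.norm_def,
          Complex.norm_real, Real.norm_eq_abs]
        simp
      have := norm_sub_le_of_bounded_on_strip hF hFB (displaced_mem_strip hUV hz b)
        (w := z + (U z, V z) + ((a : ℂ), 0)) (by rwa [hn])
      rwa [hn] at this
    have hF' := hF.mono (show ρ + B ≤ ρ + B + 1 by linarith)
    have hG' := hG.mono (show ρ + B ≤ ρ + B + 1 by linarith)
    refine dTilde_le_of_displacement (hd a) (hd b) ?_ ?_
    · refine le_trans (le_of_eq ?_) (stripNorm_le ((IsHolExtension.const ρ (a - b)).add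
        ((hU.comp_displaced hV hUV hF' a).sub (hU.comp_displaced hV hUV hF' b))) fun z hz => ?_)
      · congr 1
        ext x
        simp
        ring
      · have h := hL F hF.1 (fun z hz => (hFG z hz).1) z hz
        have h' : ‖((a - b : ℝ) : ℂ)‖ ≤ |a - b| := by rw [Complex.norm_real, Real.norm_eq_abs]
        exact (norm_add_le_of_le h' h).trans (le_of_eq (by ring))
    · refine le_trans (le_of_eq ?_) (stripNorm_le
        ((hU.comp_displaced hV hUV hG' a).sub (hU.comp_displaced hV hUV hG' b)) fun z hz => ?_)
      · congr 1
        ext x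
        simp
      · have h := hL G hG.1 (fun z hz => (hFG z hz).2) z hz
        linarith [abs_nonneg (a - b)]
  refine ⟨1 + 2 * B', by positivity, fun a b hab => max_le (key a b hab) ?_⟩
  -- The inverse is the conjugate of the opposite rotation, so the same estimate covers it.
  have hinv : ∀ c, (f * rot c * f⁻¹)⁻¹ = f * rot (-c) * f⁻¹ := by
    intro c
    simp [mul_inv_rev, rot_inv, mul_assoc]
  have h : |-a - -b| = |a - b| := by rw [← abs_neg]; ring_nf
  rw [hinv, hinv, ← h]
  exact key _ _ (by rwa [h])

end AnalyticAbC

namespace AnalyticAbC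

/-! ### Completeness -/

/-- Cauchy's estimate turns the bounds `δ n` into summable bounds on the derivatives over a ball of
half the radius, which permits differentiation term by term. -/
theorem differentiableOn_tsum_of_norm_le {δ : ℕ → ℝ} (hδ : Summable δ) {s : Set (ℂ × ℂ)}
    (hs : IsOpen s) {D : ℕ → ℂ × ℂ → ℂ} (hD : ∀ n, DifferentiableOn ℂ (D n) s)
    (hb : ∀ n, ∀ z ∈ s, ‖D n z‖ ≤ δ n) : DifferentiableOn ℂ (fun z => ∑' n, D n z) s := by
  intro z hz
  obtain ⟨r, hr, hball⟩ := Metric.isOpen_iff.1 hs z hz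
  have hsub : ∀ y ∈ Metric.ball z (r / 2), Metric.ball y (r / 2) ⊆ s := fun y hy w hw =>
    hball (by
      rw [Metric.mem_ball] at *
      linarith [dist_triangle w y z])
  have hder : ∀ n, ∀ y ∈ Metric.ball z (r / 2), ‖fderiv ℂ (D n) y‖ ≤ 2 * δ n / (r / 2) := by
    intro n y hy
    refine Complex.norm_fderiv_le_div_of_mapsTo_ball ((hD n).mono (hsub y hy)) (fun w hw => ?_)
      (by positivity)
    rw [Metric.mem_closedBall, dist_eq_norm]
    have h₁ := hb n w (hsub y hy hw)
    have h₂ := hb n y (hsub y hy (Metric.mem_ball_self (by positivity)))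
    linarith [norm_sub_le (D n w) (D n y)]
  have hzz : z ∈ Metric.ball z (r / 2) := Metric.mem_ball_self (by positivity)
  refine (hasFDerivAt_tsum_of_isPreconnected ((hδ.mul_left 2).div_const (r / 2)) Metric.isOpen_ball
    (convex_ball z (r / 2)).isPreconnected (fun n y hy => ?_) hder hzz
    (Summable.of_norm_bounded hδ fun n => hb n z hz) hzz).differentiableAt.differentiableWithinAt
  exact ((hD n).differentiableAt
    (hs.mem_nhds (hsub y hy (Metric.mem_ball_self (by positivity))))).hasFDerivAt

theorem IsHolExtension.continuous {ρ : ℝ} (hρ : 0 < ρ) {f : ℝ × ℝ → ℝ} {g : ℂ × ℂ → ℂ}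
    (h : IsHolExtension ρ f g) : Continuous f := by
  have : f = fun x : ℝ × ℝ => (g ((x.1 : ℂ), (x.2 : ℂ))).re := by
    ext x
    simp [h.2]
  rw [this]
  exact Complex.continuous_re.comp (h.1.continuousOn.comp_continuous (by fun_prop)
    (real_mem_strip hρ))

/-- A sequence of functions whose consecutive differences have summable strip norms converges,
with extensions of the remainders bounded by the tails. -/
theorem exists_limit_of_summable_stripNorm {ρ : ℝ} (hρ : 0 < ρ) {δ : ℕ → ℝ} (hδ : Summable δ)
    {a : ℕ → ℝ × ℝ → ℝ}
    (h : ∀ n, stripNorm ρ (fun x => a n x - a (n + 1) x) < ENNReal.ofReal (δ n)) :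
    ∃ b : ℝ × ℝ → ℝ, ∀ n, ∃ G, IsHolExtension ρ (fun x => a n x - b x) G ∧
      ∀ z ∈ strip ρ, ‖G z‖ ≤ ∑' m, δ (m + n) := by
  choose D hD hDb using fun n => exists_extension_of_stripNorm_lt (h n)
  have hsum : ∀ x, Summable fun n => a n x - a (n + 1) x := by
    intro x
    refine Summable.of_norm_bounded hδ fun n => ?_
    have := hDb n _ (real_mem_strip hρ x)
    rwa [(hD n).2, Complex.norm_real] at this
  -- The limit is written as a telescoping series, so that its distance to `a n` is the tail of the
  -- series and extends as the tail of the `D m`.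
  refine ⟨fun x => a 0 x - ∑' n, (a n x - a (n + 1) x), fun n =>
    ⟨fun z => ∑' m, D (m + n) z, ⟨?_, fun x => ?_⟩, fun z hz => ?_⟩⟩
  · exact differentiableOn_tsum_of_norm_le ((summable_nat_add_iff n).2 hδ) (isOpen_strip ρ)
      (fun m => (hD (m + n)).1) fun m => hDb (m + n)
  · simp only [(hD _).2]
    rw [← Complex.ofReal_tsum, ← (hsum x).sum_add_tsum_nat_add n, Finset.sum_range_sub']
    congr 1
    ring
  · exact tsum_of_norm_bounded ((summable_nat_add_iff n).2 hδ).hasSum fun m => hDb (m + n) z hz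

/-- The lift of `f` is prescribed: the integers from the infima and from the change of lift all go
into the lift of `g`. This permits a recursive choice of lifts along a sequence. -/
theorem exists_displacement_of_dTilde_lt {ρ : ℝ} {f g : Equiv.Perm Torus} {u : ℝ × ℝ → ℝ × ℝ}
    (hu : IsDisplacement f u) {c : ℝ≥0∞} (h : dTilde ρ f g < c) :
    ∃ v, IsDisplacement g v ∧ stripNorm ρ (fun x => (u x).1 - (v x).1) < c ∧
      stripNorm ρ (fun x => (u x).2 - (v x).2) < c := by
  simp only [dTilde, iInf_lt_iff, max_lt_iff] at h
  obtain ⟨u', hu', v, hv, ⟨m, hm⟩, n, hn⟩ := h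
  obtain ⟨m', n', h'⟩ := hu.exists_int hu'
  refine ⟨_, hv.add_int (m' - m) (n' - n), lt_of_eq_of_lt ?_ hm, lt_of_eq_of_lt ?_ hn⟩ <;>
  · congr 1
    ext x
    rw [h']
    push_cast
    ring

/-- With compatible lifts the integers disappear and the displacements form a Cauchy sequence. The
limit is only a map here; its invertibility comes from a second application, to the inverses. -/
theorem exists_limit_of_summable_dTilde {ρ : ℝ} (hρ : 0 < ρ) {δ : ℕ → ℝ} (hδ : Summable δ)
    {f : ℕ → Equiv.Perm Torus} (hf : HasAnalyticLift ρ (f 0))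
    (h : ∀ n, dTilde ρ (f n) (f (n + 1)) < ENNReal.ofReal (δ n)) :
    ∃ (F : Torus → Torus) (v : ℝ × ℝ → ℝ × ℝ) (u : ℕ → ℝ × ℝ → ℝ × ℝ), HasAnalyticLift ρ F ∧
      IsDisplacement F v ∧ (∀ n, IsDisplacement (f n) (u n)) ∧
      (∀ n, stripNorm ρ (fun x => (u n x).1 - (v x).1) ≤ ENNReal.ofReal (∑' m, δ (m + n))) ∧
      (∀ n, stripNorm ρ (fun x => (u n x).2 - (v x).2) ≤ ENNReal.ofReal (∑' m, δ (m + n))) ∧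
      ∀ n x, ‖u n x - v x‖ ≤ ∑' m, δ (m + n) := by
  obtain ⟨u₀, U, V, B, -, hu₀, hU, hV, hUV⟩ := hf.exists_bound
  choose next hnext h₁ h₂ using fun n (u : {u // IsDisplacement (f n) u}) =>
    exists_displacement_of_dTilde_lt u.2 (h n)
  let u : ∀ n, {u // IsDisplacement (f n) u} := fun n =>
    Nat.rec ⟨u₀, hu₀⟩ (fun n u => ⟨next n u, hnext n u⟩) n
  obtain ⟨b, hb⟩ := exists_limit_of_summable_stripNorm hρ hδ (a := fun n x => ((u n).1 x).1)
    fun n => h₁ n (u n)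
  obtain ⟨c, hc⟩ := exists_limit_of_summable_stripNorm hρ hδ (a := fun n x => ((u n).1 x).2)
    fun n => h₂ n (u n)
  choose G hG hGb using hb
  choose K hK hKb using hc
  have htail := tendsto_sum_nat_add δ
  have hbn : ∀ n x, ‖((u n).1 x).1 - b x‖ ≤ ∑' m, δ (m + n) := fun n x => by
    have := hGb n _ (real_mem_strip hρ x)
    rwa [(hG n).2, Complex.norm_real] at this
  have hcn : ∀ n x, ‖((u n).1 x).2 - c x‖ ≤ ∑' m, δ (m + n) := fun n x => by
    have := hKb n _ (real_mem_strip hρ x)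
    rwa [(hK n).2, Complex.norm_real] at this
  have hbt : ∀ x, Tendsto (fun n => ((u n).1 x).1) atTop (𝓝 (b x)) := fun x =>
    tendsto_iff_norm_sub_tendsto_zero.2 (squeeze_zero (fun _ => norm_nonneg _)
      (fun n => hbn n x) htail)
  have hct : ∀ x, Tendsto (fun n => ((u n).1 x).2) atTop (𝓝 (c x)) := fun x =>
    tendsto_iff_norm_sub_tendsto_zero.2 (squeeze_zero (fun _ => norm_nonneg _)
      (fun n => hcn n x) htail)
  have hbp : IsPeriodic b := fun x m n => tendsto_nhds_unique (hbt _)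
    (by simpa only [(u _).2.periodic] using hbt x)
  have hcp : IsPeriodic c := fun x m n => tendsto_nhds_unique (hct _)
    (by simpa only [(u _).2.periodic] using hct x)
  have hcont : Continuous fun x => (b x, c x) := by
    have e : (fun x => (b x, c x)) = fun x => u₀ x - ((u₀ x).1 - b x, (u₀ x).2 - c x) := by
      ext x <;> simp
    rw [e]
    exact hu₀.continuous.sub (((hG 0).continuous hρ).prodMk ((hK 0).continuous hρ))
  have hlift : ∀ x y, proj x = proj y → proj (x + (b x, c x)) = proj (y + (b y, c y)) := by
    intro x y hxy
    obtain ⟨m, n, rfl⟩ := proj_eq_proj_iff.1 hxy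
    rw [hbp, hcp, proj_add, hxy, ← proj_add]
  -- `F` is defined through an arbitrary section of `proj`; by `hlift` the section does not matter.
  let F : Torus → Torus := fun y =>
    proj (Function.surjInv proj_surjective y + (b (Function.surjInv proj_surjective y),
      c (Function.surjInv proj_surjective y)))
  have hF : IsDisplacement F (fun x => (b x, c x)) :=
    ⟨hcont, hbp, hcp, fun x => (hlift _ _ (Function.surjInv_eq proj_surjective _)).symm⟩
  refine ⟨F, fun x => (b x, c x), fun n => (u n).1, ?_, hF, fun n => (u n).2,
    fun n => stripNorm_le (hG n) (hGb n), fun n => stripNorm_le (hK n) (hKb n),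
    fun n x => ?_⟩
  · refine .of_bound hF (B := B + ∑' m, δ (m + 0)) (U := fun z => U z - G 0 z)
      (V := fun z => V z - K 0 z) ?_ ?_ ?_ ?_
    · have : IsHolExtension ρ (fun x => (u₀ x).1 - ((u₀ x).1 - b x)) _ := hU.sub (hG 0)
      simpa only [sub_sub_cancel] using this
    · have : IsHolExtension ρ (fun x => (u₀ x).2 - ((u₀ x).2 - c x)) _ := hV.sub (hK 0)
      simpa only [sub_sub_cancel] using this
    · exact fun z hz => norm_sub_le_of_le (hUV z hz).1 (hGb 0 z hz)
    · exact fun z hz => norm_sub_le_of_le (hUV z hz).2 (hKb 0 z hz)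
  · exact norm_prod_le_iff.2 ⟨hbn n x, hcn n x⟩

/-- A finite measure is determined by the integrals of bounded continuous functions, and these pass
to the limit by dominated convergence. -/
theorem measurePreserving_of_tendsto {X : Type*} [TopologicalSpace X] [MeasurableSpace X]
    [BorelSpace X] [HasOuterApproxClosed X] {μ : Measure X} [IsFiniteMeasure μ]
    {f : ℕ → X → X} {F : X → X} (hf : ∀ n, MeasurePreserving (f n) μ μ) (hF : Continuous F)
    (h : ∀ x, Tendsto (fun n => f n x) atTop (𝓝 (F x))) : MeasurePreserving F μ μ := by
  refine ⟨hF.measurable, ?_⟩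
  refine ext_of_forall_integral_eq_of_IsFiniteMeasure fun φ => ?_
  rw [integral_map hF.aemeasurable φ.continuous.aestronglyMeasurable]
  have hlim : Tendsto (fun n => ∫ x, φ (f n x) ∂μ) atTop (𝓝 (∫ x, φ (F x) ∂μ)) := by
    refine tendsto_integral_of_dominated_convergence (fun _ => ‖φ‖)
      (fun n => φ.continuous.measurable.comp (hf n).measurable |>.aestronglyMeasurable)
      (integrable_const _) (fun n => ae_of_all _ fun x => φ.norm_coe_le_norm _)
      (ae_of_all _ fun x => (φ.continuous.tendsto _).comp (h x))
  refine tendsto_nhds_unique hlim ?_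
  have : ∀ n, ∫ x, φ (f n x) ∂μ = ∫ x, φ x ∂μ := by
    intro n
    rw [← integral_map (hf n).measurable.aemeasurable φ.continuous.aestronglyMeasurable, (hf n).map_eq]
  simp [this]

/-- Passage to the limit in a composition of maps given by uniformly convergent displacements. -/
theorem tendsto_comp_of_displacement {f g : ℕ → Torus → Torus} {F G : Torus → Torus}
    {u v : ℕ → ℝ × ℝ → ℝ × ℝ} {w z : ℝ × ℝ → ℝ × ℝ} {c : ℕ → ℝ} (hc : Tendsto c atTop (𝓝 0))
    (hf : ∀ n, IsDisplacement (f n) (u n)) (hg : ∀ n, IsDisplacement (g n) (v n))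
    (hF : IsDisplacement F w) (hG : IsDisplacement G z) (hu : ∀ n x, ‖u n x - w x‖ ≤ c n)
    (hv : ∀ n x, ‖v n x - z x‖ ≤ c n) (y : Torus) :
    Tendsto (fun n => f n (g n y)) atTop (𝓝 (F (G y))) := by
  obtain ⟨x, rfl⟩ := proj_surjective y
  simp only [← (hg _).lift, ← (hf _).lift, ← hG.lift, ← hF.lift]
  refine (continuous_proj.tendsto _).comp ?_
  have h₁ : Tendsto (fun n => x + v n x) atTop (𝓝 (x + z x)) :=
    tendsto_const_nhds.add (tendsto_iff_norm_sub_tendsto_zero.2 (squeeze_zero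
      (fun _ => norm_nonneg _) (fun n => hv n x) hc))
  refine h₁.add ?_
  have h₂ : Tendsto (fun n => u n (x + v n x) - w (x + v n x)) atTop (𝓝 0) :=
    squeeze_zero_norm (fun n => hu n _) hc
  simpa using h₂.add ((hF.continuous.tendsto _).comp h₁)

/-- `Diff^ω_ρ(𝕋², μ)` is complete, for sequences with summable consecutive distances. -/
theorem exists_memDiff_limit {ρ : ℝ} (hρ : 0 < ρ) {δ : ℕ → ℝ} (hδ : Summable δ)
    {T : ℕ → Equiv.Perm Torus} (hT : ∀ n, MemDiff ρ (T n))
    (h : ∀ n, dRho ρ (T n) (T (n + 1)) < ENNReal.ofReal (δ n)) :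
    ∃ S, MemDiff ρ S ∧ Tendsto (fun n => dRho ρ (T n) S) atTop (𝓝 0) := by
  obtain ⟨F, w, u, hFl, hFw, hu, hu₁, hu₂, hun⟩ := exists_limit_of_summable_dTilde hρ hδ
    (hT 0).lift fun n => (le_max_left _ _).trans_lt (h n)
  obtain ⟨G, z, v, hGl, hGz, hv, hv₁, hv₂, hvn⟩ := exists_limit_of_summable_dTilde hρ hδ
    (f := fun n => (T n)⁻¹) (hT 0).lift_inv fun n => (le_max_right _ _).trans_lt (h n)
  have htail := tendsto_sum_nat_add δ
  -- The identities for `T n` and its inverse pass to the limit.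
  have hFG : ∀ y, F (G y) = y := fun y => tendsto_nhds_unique
    (tendsto_comp_of_displacement htail hu hv hFw hGz hun hvn y) (by simp)
  have hGF : ∀ y, G (F y) = y := fun y => tendsto_nhds_unique
    (tendsto_comp_of_displacement htail hv hu hGz hFw hvn hun y) (by simp)
  have hid : ∀ f : Torus → Torus, f = id → IsDisplacement f 0 := by
    rintro _ rfl
    exact ⟨continuous_const, fun _ _ _ => rfl, fun _ _ _ => rfl, fun _ => by simp⟩
  -- Pointwise convergence is the special case of composition with the identity, whose displacement
  -- is zero.
  have hFt : ∀ y, Tendsto (fun n => T n y) atTop (𝓝 (F y)) := fun y => by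
    simpa using tendsto_comp_of_displacement (g := fun _ => id) (G := id) (v := fun _ => 0)
      (z := 0) htail hu (fun _ => hid _ rfl) hFw (hid _ rfl) hun
      (fun n x => by simpa using (norm_nonneg _).trans (hun n x)) y
  refine ⟨⟨F, G, hGF, hFG⟩, ⟨?_, hFl, hGl⟩, ?_⟩
  · exact measurePreserving_of_tendsto (fun n => (hT n).measurePreserving) hFw.continuous_map hFt
  · refine tendsto_of_tendsto_of_tendsto_of_le_of_le tendsto_const_nhds
      (h := fun n => ENNReal.ofReal (∑' m, δ (m + n))) ?_ (fun _ => zero_le) fun n => max_le ?_ ?_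
    · simpa using ENNReal.tendsto_ofReal htail
    · exact dTilde_le_of_displacement (hu n) hFw (hu₁ n) (hu₂ n)
    · exact dTilde_le_of_displacement (hv n) hGz (hv₁ n) (hv₂ n)

end AnalyticAbC

namespace AnalyticAbC

/-! ### The circular operator -/

section Circ

variable {A : Type*}

/-- The letters of the alphabet, as opposed to the spacers. -/
def Letter.isSym : Letter A → Bool
  | .sym _ => true
  | .b => false
  | .e => false

theorem jIndex_le {p q i : ℕ} (hq : 0 < q) : jIndex p q i ≤ q := by
  have : NeZero q := ⟨hq.ne'⟩
  exact (ZMod.val_lt _).le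

theorem length_circ {p q l c : ℕ} {ws : List (Word A)} (h : ∀ w ∈ ws, w.length = c) :
    (circ p q l ws).length = q * (ws.length * (q + (l - 1) * c)) := by
  have hblock : ∀ i ∈ List.range q, (ws.flatMap fun w => List.replicate (q - jIndex p q i) Letter.b ++
      (List.replicate (l - 1) w).flatten ++ List.replicate (jIndex p q i) Letter.e).length =
      ws.length * (q + (l - 1) * c) := by
    intro i hi
    have hj := jIndex_le (p := p) (i := i) (Nat.zero_lt_of_lt (List.mem_range.1 hi))
    rw [List.length_flatMap, List.map_congr_left (g := fun _ => q + (l - 1) * c)]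
    · simp
    · intro w hw
      simp [h w hw]
      omega
  rw [circ, List.length_flatMap, List.map_congr_left hblock]
  simp

theorem countP_isSym_circ {p q l c : ℕ} {ws : List (Word A)}
    (h : ∀ w ∈ ws, w.countP Letter.isSym = c) :
    (circ p q l ws).countP Letter.isSym = q * (ws.length * ((l - 1) * c)) := by
  have hblock : ∀ i ∈ List.range q, (ws.flatMap fun w => List.replicate (q - jIndex p q i) Letter.b ++
      (List.replicate (l - 1) w).flatten ++
        List.replicate (jIndex p q i) Letter.e).countP Letter.isSym =
      ws.length * ((l - 1) * c) := by
    intro i _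
    rw [List.countP_flatMap, List.map_congr_left (g := fun _ => (l - 1) * c)]
    · simp
    · intro w hw
      simp [h w hw, List.countP_append, List.countP_flatten, List.countP_replicate, Letter.isSym]
  rw [circ, List.countP_flatMap, Function.comp_def, List.map_congr_left hblock]
  simp

theorem flatMap_inj_of_length {α β : Type*} {f : α → List β} {c : ℕ} {S : Set α}
    (hc : ∀ x ∈ S, (f x).length = c) (hf : Set.InjOn f S) :
    ∀ {l l' : List α}, (∀ x ∈ l, x ∈ S) → (∀ x ∈ l', x ∈ S) → l.length = l'.length →
      l.flatMap f = l'.flatMap f → l = l'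
  | [], [], _, _, _, _ => rfl
  | a :: l, a' :: l', h, h', hlen, heq => by
    simp only [List.forall_mem_cons] at h h'
    rw [List.flatMap_cons, List.flatMap_cons] at heq
    obtain ⟨h₁, h₂⟩ := List.append_inj heq (by rw [hc a h.1, hc a' h'.1])
    rw [hf h.1 h'.1 h₁, flatMap_inj_of_length hc hf h.2 h'.2 (by simpa using hlen) h₂]

/-- With `l ≥ 2` each word appears in its block at least once. The blocks with `i = 0` already run
through the whole tuple, and having equal lengths they can be cut apart. -/
theorem circ_injective {p q l c : ℕ} (hq : 0 < q) (hl : 2 ≤ l) {ws ws' : List (Word A)}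
    (h : ∀ w ∈ ws, w.length = c) (h' : ∀ w ∈ ws', w.length = c) (hlen : ws.length = ws'.length)
    (heq : circ p q l ws = circ p q l ws') : ws = ws' := by
  obtain ⟨q, rfl⟩ := Nat.exists_eq_add_one.2 hq
  obtain ⟨l, rfl⟩ := Nat.exists_eq_add_of_le' hl
  have hblock : ∀ w : Word A, w ∈ {w : Word A | w.length = c} →
      (List.replicate (q + 1 - jIndex p (q + 1) 0) Letter.b ++
      (List.replicate (l + 2 - 1) w).flatten ++
        List.replicate (jIndex p (q + 1) 0) Letter.e).length = q + 1 + (l + 1) * c := by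
    intro w hw
    have hj : jIndex p (q + 1) 0 ≤ q + 1 := jIndex_le q.succ_pos
    rw [Set.mem_ofPred_eq] at hw
    simp [hw]
    omega
  rw [circ, circ, List.range_succ_eq_map, List.flatMap_cons, List.flatMap_cons] at heq
  refine flatMap_inj_of_length hblock ?_ h h' hlen (List.append_inj_left heq ?_)
  · intro w hw w' hw' he
    rw [Set.mem_ofPred_eq] at hw hw'
    simp only [List.append_cancel_left_eq, List.append_left_inj] at he
    rw [show l + 2 - 1 = l + 1 from rfl, List.replicate_succ, List.replicate_succ,
      List.flatten_cons, List.flatten_cons] at he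
    exact List.append_inj_left he (by rw [hw, hw'])
  · rw [List.length_flatMap, List.length_flatMap, List.map_congr_left fun w hw => hblock w (h w hw),
      List.map_congr_left fun w hw => hblock w (h' w hw)]
    simp [hlen]

end Circ

/-! ### Realizable sequences -/

namespace CircularSequence

variable {A : Type*} {U V : CircularSequence A}

theorem q_succ (U : CircularSequence A) (n : ℕ) :
    U.q (n + 1) = U.k n * U.l n * U.q n ^ 2 := rfl

theorem p_succ (U : CircularSequence A) (n : ℕ) :
    U.p (n + 1) = U.p n * U.q n * U.k n * U.l n + 1 := rfl

theorem pq_congr {k k' l l' : ℕ → ℕ} : ∀ {n : ℕ}, (∀ i < n, k i = k' i) → (∀ i < n, l i = l' i) →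
    pq k l n = pq k' l' n
  | 0, _, _ => rfl
  | n + 1, hk, hl => by
    simp only [pq]
    rw [pq_congr (fun i hi => hk i (hi.trans n.lt_succ_self))
      (fun i hi => hl i (hi.trans n.lt_succ_self)), hk n n.lt_succ_self, hl n n.lt_succ_self]

namespace Realizable

/-- By divisibility a zero would persist, against `s → ∞`. -/
theorem s_pos (hU : U.Realizable) (n : ℕ) : 0 < U.s n := by
  by_contra h
  have hz : ∀ m, U.s (n + m) = 0 := by
    intro m
    induction m with
    | zero => simpa using h
    | succ m ih => exact Nat.eq_zero_of_zero_dvd (ih ▸ hU.s_dvd_s (n + m))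
  obtain ⟨N, hN⟩ := (hU.tendsto_s.eventually_gt_atTop 0).exists_forall_of_atTop
  have := hN (n + N) (by omega)
  rw [hz N] at this
  exact this.false

/-- A zero would persist, and then `circ` yields only the empty word, so that `s` stays at most `1`.
-/
theorem q_pos (hU : U.Realizable) (n : ℕ) : 0 < U.q n := by
  by_contra h
  have hz : ∀ m, U.q (n + m) = 0 := by
    intro m
    induction m with
    | zero => simpa using h
    | succ m ih => rw [← add_assoc, q_succ, ih]; simp
  have hs : ∀ m, U.s (n + m + 1) ≤ 1 := by
    intro m
    refine Finset.card_le_one.2 fun v hv w hw => ?_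
    rw [U.mem_W_succ] at hv hw
    obtain ⟨_, _, rfl⟩ := hv
    obtain ⟨_, _, rfl⟩ := hw
    have hq : (pq U.k U.l (n + m)).2 = 0 := hz m
    simp [circ, hq]
  obtain ⟨N, hN⟩ := (hU.tendsto_s.eventually_gt_atTop 1).exists_forall_of_atTop
  have := hN (n + N + 1) (by omega)
  have := hs N
  omega

theorem k_pos (hU : U.Realizable) (n : ℕ) : 0 < U.k n := by
  have := hU.q_pos (n + 1)
  rw [q_succ] at this
  exact Nat.pos_of_mul_pos_right (Nat.pos_of_mul_pos_right this)

theorem l_pos (hU : U.Realizable) (n : ℕ) : 0 < U.l n := by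
  have := hU.q_pos (n + 1)
  rw [q_succ] at this
  exact Nat.pos_of_mul_pos_left (Nat.pos_of_mul_pos_right this)

theorem exists_mem (hU : U.Realizable) (n : ℕ) : ∃ w, w ∈ U.W n :=
  Finset.card_pos.1 (hU.s_pos n)

theorem length_eq (hU : U.Realizable) : ∀ {n : ℕ} {w : Word A}, w ∈ U.W n → w.length = U.q n
  | 0, w, hw => by
    obtain ⟨a, _, rfl⟩ := (U.mem_W_zero w).1 hw
    rfl
  | n + 1, w, hw => by
    obtain ⟨ws, hws, rfl⟩ := (U.mem_W_succ n w).1 hw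
    rw [length_circ (c := U.q n) fun w hw => hU.length_eq (U.mem_W_of_mem_P n ws hws w hw),
      U.length_of_mem_P n ws hws, q_succ]
    obtain ⟨l, hl⟩ := Nat.exists_eq_add_one.2 (hU.l_pos n)
    rw [hl]
    change U.q n * _ = _
    change U.q n * (U.k n * (U.q n + l * U.q n)) = _
    ring

theorem countP_mem_succ {c n : ℕ} (hc : ∀ w ∈ U.W n, w.countP Letter.isSym = c) {w : Word A}
    (hw : w ∈ U.W (n + 1)) :
    w.countP Letter.isSym = U.q n * (U.k n * ((U.l n - 1) * c)) := by
  obtain ⟨ws, hws, rfl⟩ := (U.mem_W_succ n w).1 hw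
  rw [countP_isSym_circ fun w hw => hc w (U.mem_W_of_mem_P n ws hws w hw),
    U.length_of_mem_P n ws hws]
  rfl

/-- The words of `W_n` have the same, positive number of letters of the alphabet. -/
theorem exists_countP_eq (hU : U.Realizable) :
    ∀ n, ∃ c, 0 < c ∧ ∀ w ∈ U.W n, w.countP Letter.isSym = c
  | 0 => by
    refine ⟨1, one_pos, fun w hw => ?_⟩
    obtain ⟨a, _, rfl⟩ := (U.mem_W_zero w).1 hw
    rfl
  | n + 1 => by
    obtain ⟨c, hc, h⟩ := hU.exists_countP_eq n
    refine ⟨_, ?_, fun w hw => countP_mem_succ h hw⟩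
    obtain ⟨w, hw⟩ := hU.exists_mem n
    obtain ⟨w', hw'⟩ := hU.exists_mem (n + 1)
    -- Positivity is inherited because each new word contains an old one.
    have := (U.contains n w' hw' w hw).sublist.countP_le (p := Letter.isSym)
    rw [countP_mem_succ h hw', h w hw] at this
    omega

/-- For `l = 1` the new words would consist of spacers only. -/
theorem two_le_l (hU : U.Realizable) (n : ℕ) : 2 ≤ U.l n := by
  obtain ⟨c, hc, h⟩ := hU.exists_countP_eq n
  obtain ⟨c', hc', h'⟩ := hU.exists_countP_eq (n + 1)
  obtain ⟨w, hw⟩ := hU.exists_mem (n + 1)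
  rw [← h' w hw, countP_mem_succ h hw] at hc'
  have := Nat.pos_of_mul_pos_right (Nat.pos_of_mul_pos_left (Nat.pos_of_mul_pos_left hc'))
  omega

/-- Two consecutive collections of words determine the parameters. -/
theorem k_eq_and_l_eq (hU : U.Realizable) (hV : V.Realizable) {n : ℕ} (hW : U.W n = V.W n)
    (hW' : U.W (n + 1) = V.W (n + 1)) (hq : U.q n = V.q n) : U.k n = V.k n ∧ U.l n = V.l n := by
  obtain ⟨c, hc, h⟩ := hU.exists_countP_eq n
  obtain ⟨w, hw⟩ := hU.exists_mem (n + 1)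
  have h₁ := hU.length_eq hw
  rw [hV.length_eq (hW' ▸ hw), q_succ, q_succ, hq] at h₁
  have h₁ := Nat.eq_of_mul_eq_mul_right (pow_pos (hV.q_pos n) 2) h₁
  have h₂ := countP_mem_succ h hw
  rw [countP_mem_succ (U := V) (hW ▸ h) (hW' ▸ hw), hq] at h₂
  have h₂ := Nat.eq_of_mul_eq_mul_left (hV.q_pos n) h₂
  rw [← mul_assoc, ← mul_assoc] at h₂
  have h₂ := Nat.eq_of_mul_eq_mul_right hc h₂
  -- The length gives `k * l` and the letter count gives `k * (l - 1)`; their difference is `k`.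
  have hk : U.k n = V.k n := by
    obtain ⟨a, ha⟩ := Nat.exists_eq_add_one.2 (hU.l_pos n)
    obtain ⟨b, hb⟩ := Nat.exists_eq_add_one.2 (hV.l_pos n)
    simp only [ha, hb, Nat.add_sub_cancel, mul_add] at h₁ h₂
    omega
  exact ⟨hk, (Nat.eq_of_mul_eq_mul_left (hV.k_pos n) (hk ▸ h₁)).symm⟩

theorem P_subset (hV : V.Realizable) {n : ℕ} (hW : U.W n = V.W n)
    (hW' : U.W (n + 1) = V.W (n + 1)) (hpq : pq U.k U.l n = pq V.k V.l n) (hk : U.k n = V.k n)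
    (hl : U.l n = V.l n) : U.P n ⊆ V.P n := by
  intro ws hws
  have h := (U.mem_W_succ n _).2 ⟨ws, hws, rfl⟩
  rw [hW', V.mem_W_succ] at h
  obtain ⟨ws', hws', he⟩ := h
  have hlen : ∀ w ∈ ws, w.length = V.q n := fun w hw =>
    hV.length_eq (hW ▸ U.mem_W_of_mem_P n ws hws w hw)
  rw [hpq, hl] at he
  have := circ_injective (hV.q_pos n) (hV.two_le_l n)
    (fun w hw => hV.length_eq (V.mem_W_of_mem_P n ws' hws' w hw)) hlen
    (by rw [V.length_of_mem_P n ws' hws', U.length_of_mem_P n ws hws, hk]) he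
  exact this ▸ hws'

theorem P_eq (hU : U.Realizable) (hV : V.Realizable) {n : ℕ} (hW : U.W n = V.W n)
    (hW' : U.W (n + 1) = V.W (n + 1)) (hpq : pq U.k U.l n = pq V.k V.l n) (hk : U.k n = V.k n)
    (hl : U.l n = V.l n) : U.P n = V.P n :=
  (P_subset hV hW hW' hpq hk hl).antisymm
    (P_subset hU hW.symm hW'.symm hpq.symm hk.symm hl.symm)

/-- The collections `W_0, …, W_n` determine `p_n` and `q_n`. -/
theorem pq_eq (hU : U.Realizable) (hV : V.Realizable) :
    ∀ {n : ℕ}, (∀ m ≤ n, U.W m = V.W m) → pq U.k U.l n = pq V.k V.l n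
  | 0, _ => rfl
  | n + 1, h => by
    have ih := pq_eq hU hV fun m hm => h m (hm.trans n.le_succ)
    obtain ⟨hk, hl⟩ := k_eq_and_l_eq hU hV (h n n.le_succ) (h (n + 1) le_rfl)
      (congrArg Prod.snd ih)
    simp only [pq, ih, hk, hl]

end Realizable

open Classical in
theorem tuple_eq {n : ℕ} (hP : U.P n = V.P n) (hpq : pq U.k U.l n = pq V.k V.l n)
    (hl : U.l n = V.l n) : U.tuple n = V.tuple n := by
  ext1 v
  -- Exhibiting the choice as a function of the data lets equal data be substituted inside the
  -- dependent `if`.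
  have hdef : ∀ U : CircularSequence A, U.tuple n v =
      (fun (P : Finset (List (Word A))) (x : ℕ × ℕ) l =>
        if h : ∃ ws ∈ P, circ x.1 x.2 l ws = v then h.choose else [])
          (U.P n) (pq U.k U.l n) (U.l n) := fun _ => rfl
  rw [hdef, hdef, hP, hpq, hl]

/-- A bound for `s_n` in terms of the `k_i`. -/
def sBound (k : ℕ → ℕ) : ℕ → ℕ
  | 0 => k 0
  | n + 1 => sBound k n ^ k n

theorem sBound_congr {k k' : ℕ → ℕ} : ∀ {n : ℕ}, (∀ i < n + 1, k i = k' i) →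
    sBound k n = sBound k' n
  | 0, h => h 0 one_pos
  | n + 1, h => by
    rw [sBound, sBound, sBound_congr fun i hi => h i (by omega), h n (by omega)]

theorem s_succ_le (U : CircularSequence A) (n : ℕ) : U.s (n + 1) ≤ U.s n ^ U.k n := by
  classical
  have h₁ : U.W (n + 1) ⊆ (U.P n).image (circ (pq U.k U.l n).1 (pq U.k U.l n).2 (U.l n)) := by
    intro w hw
    simpa using (U.mem_W_succ n w).1 hw
  have h₂ : U.P n ⊆ (Fintype.piFinset fun _ : Fin (U.k n) => U.W n).image List.ofFn := by
    intro ws hws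
    have hlen := U.length_of_mem_P n ws hws
    refine Finset.mem_image.2 ⟨fun i => ws[i]'(by omega), Fintype.mem_piFinset.2 fun i =>
      U.mem_W_of_mem_P n ws hws _ (List.getElem_mem _), ?_⟩
    exact List.ext_getElem (by simp [hlen]) fun i h h' => by simp
  calc U.s (n + 1) ≤ _ := Finset.card_le_card h₁
    _ ≤ _ := Finset.card_image_le
    _ ≤ _ := Finset.card_le_card h₂
    _ ≤ _ := Finset.card_image_le
    _ = U.s n ^ U.k n := by simp [s]

/-- The alphabet itself is bounded through `s_0 ∣ k_0`; without this start the `k_i` would not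
control the `s_n`. -/
theorem Realizable.s_le (hU : U.Realizable) : ∀ n, U.s n ≤ sBound U.k n
  | 0 => Nat.le_of_dvd (hU.k_pos 0) (hU.s_dvd_k 0)
  | n + 1 => (U.s_succ_le n).trans (Nat.pow_le_pow_left (hU.s_le n) _)

end CircularSequence

/-! ### The approximating diffeomorphisms -/

namespace Choices

variable {A : Type*} {ε : ℕ → ℝ} (C : Choices A ε) {U V : CircularSequence A}

theorem h_eq (hU : U.Realizable) (hV : V.Realizable) {n : ℕ} (h : ∀ m ≤ n + 1, U.W m = V.W m) :
    C.h U n = C.h V n := by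
  have hW := h n n.le_succ
  have hW' := h (n + 1) le_rfl
  have hpq := hU.pq_eq hV fun m hm => h m (hm.trans n.le_succ)
  have hq : U.q n = V.q n := congrArg Prod.snd hpq
  obtain ⟨hk, hl⟩ := hU.k_eq_and_l_eq hV hW hW' hq
  have hcode : C.code U n = C.code V n := by
    have := CircularSequence.tuple_eq (hU.P_eq hV hW hW' hpq hk hl) hpq hl
    ext i t
    simp only [code, hW, hW', this]
  -- The type of the permutation depends on `k` and `s'`, so these are abstracted before rewriting.
  have hstep : ∀ U : CircularSequence A, C.h U n = (fun k q s s' J =>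
      C.diffeo (n + 1) k q s' (C.perm k s s' J)) (U.k n) (U.q n) (U.s n) (U.s (n + 1))
        (C.code U n) := fun _ => rfl
  rw [hstep, hstep, hk, hq, hcode, show U.s n = V.s n from congrArg _ hW,
    show U.s (n + 1) = V.s (n + 1) from congrArg _ hW']

theorem H_eq (hU : U.Realizable) (hV : V.Realizable) :
    ∀ {n : ℕ}, (∀ m ≤ n, U.W m = V.W m) → C.H U n = C.H V n
  | 0, _ => rfl
  | n + 1, h => by
    rw [H, H, H_eq hU hV fun m hm => h m (hm.trans n.le_succ), C.h_eq hU hV h]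

theorem T_eq (hU : U.Realizable) (hV : V.Realizable) {n : ℕ} (h : ∀ m ≤ n, U.W m = V.W m) :
    C.T U n = C.T V n := by
  simp only [T, CircularSequence.p, CircularSequence.q, C.H_eq hU hV h, hU.pq_eq hV h]

/-- Here `q_n` is fixed by the earlier parameters, `s_{n+1}` is bounded, and each grid has finitely
many permutations. The parameter `l_n` can influence only which of these is taken. -/
theorem finite_setOf_h (n : ℕ) (k l : ℕ → ℕ) :
    {f | ∃ U : CircularSequence A, U.Realizable ∧ (∀ i < n + 1, U.k i = k i) ∧
      (∀ i < n, U.l i = l i) ∧ C.h U n = f}.Finite := by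
  refine Set.Finite.subset (Set.Finite.biUnion
    (Set.finite_Iic (CircularSequence.sBound k n ^ k n)) fun s _ =>
    Set.finite_range fun τ : Equiv.Perm (Fin (k n) × Fin s) =>
      C.diffeo (n + 1) (k n) (pq k l n).2 s τ) ?_
  rintro _ ⟨U, hU, hk, hl, rfl⟩
  refine Set.mem_biUnion (x := U.s (n + 1)) ?_ ?_
  · rw [Set.mem_Iic, ← CircularSequence.sBound_congr hk, ← hk n n.lt_succ_self]
    exact hU.s_le (n + 1)
  · rw [← CircularSequence.pq_congr (fun i hi => hk i (hi.trans n.lt_succ_self)) hl,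
      ← hk n n.lt_succ_self]
    exact ⟨C.partitionPerm U n, rfl⟩

/-- Only finitely many `H_{n+1}` occur for given `k_0, …, k_n` and `l_0, …, l_{n-1}`. -/
theorem finite_setOf_H (k l : ℕ → ℕ) : ∀ n : ℕ,
    {f | ∃ U : CircularSequence A, U.Realizable ∧ (∀ i < n, U.k i = k i) ∧
      (∀ i < n - 1, U.l i = l i) ∧ C.H U n = f}.Finite
  | 0 => (Set.finite_singleton 1).subset (by rintro _ ⟨U, -, -, -, rfl⟩; rfl)
  | n + 1 => by
    refine ((finite_setOf_H k l n).image2 (· * ·) (C.finite_setOf_h n k l)).subset ?_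
    rintro _ ⟨U, hU, hk, hl, rfl⟩
    exact ⟨_, ⟨U, hU, fun i hi => hk i (by omega), fun i hi => hl i (by omega), rfl⟩,
      _, ⟨U, hU, hk, hl, rfl⟩, rfl⟩

theorem memDiffInf_H (U : CircularSequence A) : ∀ n, MemDiffInf (C.H U n)
  | 0 => memDiffInf_one
  | n + 1 => (memDiffInf_H U n).mul (C.diffeo_mem _ _ _ _ _)

theorem memDiff_T (ρ : ℝ) (U : CircularSequence A) (n : ℕ) : MemDiff ρ (C.T U n) := by
  exact (((C.memDiffInf_H U n).mul (memDiffInf_rot _)).mul (C.memDiffInf_H U n).inv).memDiff ρ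

/-- `T_n` is also conjugate to `R^{α_n}` by `H_{n+1}`. -/
theorem T_eq_conj_succ (U : CircularSequence A) (n : ℕ) :
    C.T U n = C.H U (n + 1) * rot ((U.p n : ℝ) / (U.q n : ℝ)) * (C.H U (n + 1))⁻¹ := by
  -- The angle is an integer multiple of `1 / q_n`.
  have hc : Commute (C.h U n) (rot ((U.p n : ℝ) / (U.q n : ℝ))) := by
    rw [show (U.p n : ℝ) / (U.q n : ℝ) = U.p n * (1 / (U.q n : ℝ)) by ring, rot_nat_mul]
    exact (C.diffeo_comm _ _ _ _ _).pow_right _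
  have := hc.eq
  rw [T, H, mul_inv_rev, mul_assoc (C.H U n) (C.h U n), this]
  group

end Choices

end AnalyticAbC

/-! ### Thresholds and the conclusion -/

namespace AnalyticAbC

theorem dRho_le_sum_add (ρ : ℝ) {δ : ℕ → ℝ} (hδ : ∀ n, 0 ≤ δ n) {T : ℕ → Equiv.Perm Torus}
    (h : ∀ n, dRho ρ (T n) (T (n + 1)) < ENNReal.ofReal (δ n)) (S : Equiv.Perm Torus) (n : ℕ) :
    ∀ N, dRho ρ (T n) S ≤
      ENNReal.ofReal (∑ m ∈ Finset.range N, δ (m + n)) + dRho ρ (T (N + n)) S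
  | 0 => by simp
  | N + 1 => by
    rw [Finset.sum_range_succ, ENNReal.ofReal_add (Finset.sum_nonneg fun _ _ => hδ _) (hδ _),
      add_assoc]
    refine (dRho_le_sum_add ρ hδ h S n N).trans ?_
    gcongr
    refine (dRho_triangle ρ _ (T (N + n + 1)) _).trans ?_
    rw [add_right_comm]
    gcongr
    rw [add_right_comm N 1 n]
    exact (h _).le

/-- This holds for an arbitrary limit `S`, so uniqueness of realizations is never needed. -/
theorem dRho_le_tsum {ρ : ℝ} {δ : ℕ → ℝ} (hδ : ∀ n, 0 ≤ δ n) (hs : Summable δ)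
    {T : ℕ → Equiv.Perm Torus} (h : ∀ n, dRho ρ (T n) (T (n + 1)) < ENNReal.ofReal (δ n))
    {S : Equiv.Perm Torus} (hS : Tendsto (fun n => dRho ρ (T n) S) atTop (𝓝 0)) (n : ℕ) :
    dRho ρ (T n) S ≤ ENNReal.ofReal (∑' m, δ (m + n)) := by
  have h₁ : Tendsto (fun N => ENNReal.ofReal (∑' m, δ (m + n)) + dRho ρ (T (N + n)) S) atTop
      (𝓝 (ENNReal.ofReal (∑' m, δ (m + n)) + 0)) :=
    tendsto_const_nhds.add (hS.comp (tendsto_add_atTop_nat n))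
  rw [add_zero] at h₁
  refine ge_of_tendsto' h₁ fun N => (dRho_le_sum_add ρ hδ h S n N).trans ?_
  gcongr
  exact ((summable_nat_add_iff n).2 hs).sum_le_tsum _ fun _ _ => hδ _

theorem eventually_dRho_conj_rot_lt (ρ : ℝ) {f : Equiv.Perm Torus} (hf : MemDiffInf f) {c : ℝ}
    (hc : 0 < c) : ∀ᶠ l : ℕ in atTop, ∀ a b : ℝ, |a - b| ≤ 1 / l →
      dRho ρ (f * rot a * f⁻¹) (f * rot b * f⁻¹) < ENNReal.ofReal c := by
  obtain ⟨K, hK, h⟩ := exists_dRho_conj_rot_le ρ hf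
  have h₁ : Tendsto (fun l : ℕ => (1 : ℝ) / l) atTop (𝓝 0) := tendsto_one_div_atTop_nhds_zero_nat
  have h₂ : Tendsto (fun l : ℕ => K * ((1 : ℝ) / l)) atTop (𝓝 0) := by
    simpa using h₁.const_mul K
  filter_upwards [h₁.eventually_lt_const one_pos, h₂.eventually_lt_const hc] with l hl hl' a b hab
  refine (h a b (hab.trans_lt hl)).trans_lt ((ENNReal.ofReal_lt_ofReal_iff hc).2 ?_)
  exact (mul_le_mul_of_nonneg_left hab hK).trans_lt hl'

/-- The recursion makes the difference of the angles exactly `1 / q_{n+1}`. -/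
theorem CircularSequence.Realizable.abs_sub_le {A : Type*} {U : CircularSequence A}
    (hU : U.Realizable) (n : ℕ) :
    |(U.p n : ℝ) / U.q n - (U.p (n + 1) : ℝ) / U.q (n + 1)| ≤ 1 / U.l n := by
  have hk : (1 : ℝ) ≤ U.k n := by exact_mod_cast hU.k_pos n
  have hl : (0 : ℝ) < U.l n := by exact_mod_cast hU.l_pos n
  have hq : (1 : ℝ) ≤ U.q n := by exact_mod_cast hU.q_pos n
  have e : (U.p n : ℝ) / U.q n - (U.p (n + 1) : ℝ) / U.q (n + 1) =
      -(1 / (U.k n * U.l n * U.q n ^ 2)) := by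
    rw [CircularSequence.p_succ, CircularSequence.q_succ]
    push_cast
    have : (U.k n : ℝ) ≠ 0 := by positivity
    have : (U.q n : ℝ) ≠ 0 := by positivity
    field_simp
    ring
  rw [e, abs_neg, abs_of_pos (by positivity)]
  refine one_div_le_one_div_of_le hl ?_
  have : 1 ≤ (U.k n : ℝ) * U.q n ^ 2 := one_le_mul_of_one_le_of_one_le hk (one_le_pow₀ hq)
  nlinarith

/-- If each `l_n` is large, depending on the previous parameters, then consecutive `T_n` are as
close as prescribed. -/
theorem Choices.exists_threshold {A : Type*} {ε : ℕ → ℝ} (C : Choices A ε) (ρ : ℝ) {δ : ℕ → ℝ}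
    (hδ : ∀ n, 0 < δ n) : ∃ lStar : Threshold, ∀ U : CircularSequence A, U.Realizable → ∀ n,
      lStar.BoundAt U n → dRho ρ (C.T U n) (C.T U (n + 1)) < ENNReal.ofReal (δ n) := by
  have key : ∀ (n : ℕ) (k : Fin (n + 1) → ℕ) (l : Fin n → ℕ), ∃ L, ∀ U : CircularSequence A,
      U.Realizable → (fun i : Fin (n + 1) => U.k i) = k → (fun i : Fin n => U.l i) = l →
      L ≤ U.l n → dRho ρ (C.T U n) (C.T U (n + 1)) < ENNReal.ofReal (δ n) := by
    intro n k l
    by_cases hex : ∃ U : CircularSequence A, U.Realizable ∧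
        (fun i : Fin (n + 1) => U.k i) = k ∧ (fun i : Fin n => U.l i) = l
    · obtain ⟨U₀, -, rfl, rfl⟩ := hex
      have hev := (eventually_all_finite (l := atTop) (C.finite_setOf_H U₀.k U₀.l (n + 1))
        (p := fun f (l : ℕ) => ∀ a b : ℝ, |a - b| ≤ 1 / l →
          dRho ρ (f * rot a * f⁻¹) (f * rot b * f⁻¹) < ENNReal.ofReal (δ n))).2 (by
        rintro _ ⟨U, -, -, -, rfl⟩
        exact eventually_dRho_conj_rot_lt ρ (C.memDiffInf_H U _) (hδ n))
      obtain ⟨L, hL⟩ := eventually_atTop.1 hev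
      refine ⟨L, fun U hU hk hl hLU => ?_⟩
      rw [C.T_eq_conj_succ]
      exact hL _ hLU _ ⟨U, hU, fun i hi => congrFun hk ⟨i, hi⟩, fun i hi => congrFun hl ⟨i, hi⟩,
        rfl⟩ _ _ (hU.abs_sub_le n)
    -- No sequence has these parameters, so any threshold will do.
    · exact ⟨0, fun U hU hk hl => (hex ⟨U, hU, hk, hl⟩).elim⟩
  choose L hL using key
  exact ⟨L, fun U hU n h => hL n _ _ U hU rfl rfl h⟩

end AnalyticAbC

open AnalyticAbC
theorem proposition58 {A : Type*} (ρ : ℝ) (hρ : 0 < ρ) (ε : ℕ → ℝ) (hε_pos : ∀ n, 0 < ε n)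
    (hε_sum : Summable ε) (hε_tail : ∀ n, ∑' m, ε (n + 1 + m) < ε n / 2) (C : Choices A ε) :
    ∃ lStar : Threshold,
      -- the defining property of fast enough growth
      (∀ U : CircularSequence A, U.Realizable → ∀ n, lStar.BoundAt U n →
        dRho ρ (C.T U n) (C.T U (n + 1)) < ENNReal.ofReal (ε n / 2)) ∧
      -- existence of the realizations
      (∀ U : CircularSequence A, U.Realizable → (∀ n, lStar.BoundAt U n) →
        ∃ S, C.IsRealization ρ U S) ∧
      -- closeness of the realizations
      (∀ U W : CircularSequence A, U.Realizable → W.Realizable →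
        (∀ n, lStar.BoundAt U n) → (∀ n, lStar.BoundAt W n) →
        ∀ S T, C.IsRealization ρ U S → C.IsRealization ρ W T →
        ∀ M : ℕ, (∀ n < M, U.W n = W.W n) →
          dRho ρ S T < ENNReal.ofReal (ε M)) := by
  -- Bounds `δ n = ε (n + 1) / 8` have tail from `M - 1` on equal to `ε M / 8` plus less than `ε M /
  -- 16`, which twice over is still below `ε M`.
  have hδ_pos : ∀ n, 0 < ε (n + 1) / 8 := fun n => by have := hε_pos (n + 1); positivity
  have hδ_nonneg := fun n => (hδ_pos n).le
  have hδ_sum : Summable fun n => ε (n + 1) / 8 := ((summable_nat_add_iff 1).2 hε_sum).div_const 8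
  have htail : ∀ n, ∑' m, ε (m + n + 1) / 8 < ε n / 16 := fun n => by
    have := hε_tail n
    rw [tsum_div_const, tsum_congr fun m => by rw [show m + n + 1 = n + 1 + m by omega]]
    linarith
  have hδ_lt : ∀ n, ε (n + 1) / 8 < ε n / 16 := fun n => by
    refine lt_of_le_of_lt ?_ (htail n)
    have := ((summable_nat_add_iff n).2 hδ_sum).le_tsum 0 fun m _ => hδ_nonneg (m + n)
    simpa using this
  obtain ⟨lStar, hl⟩ := C.exists_threshold ρ hδ_pos
  refine ⟨lStar, fun U hU n h => (hl U hU n h).trans_le (ENNReal.ofReal_le_ofReal ?_),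
    fun U hU h => ?_, fun U W hU hW hUl hWl S T hS hT M hUW => ?_⟩
  · linarith [hδ_lt n, hε_pos n]
  · exact exists_memDiff_limit hρ hδ_sum (C.memDiff_T ρ U) fun n => hl U hU n (h n)
  · have hclose : ∀ n, C.T U n = C.T W n → ∑' m, ε (m + n + 1) / 8 < ε M / 2 →
        dRho ρ S T < ENNReal.ofReal (ε M) := by
      intro n hn hlt
      have h₁ := dRho_le_tsum hδ_nonneg hδ_sum (fun n => hl U hU n (hUl n)) hS.2 n
      have h₂ := dRho_le_tsum hδ_nonneg hδ_sum (fun n => hl W hW n (hWl n)) hT.2 n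
      have h₀ : 0 ≤ ∑' m, ε (m + n + 1) / 8 := tsum_nonneg fun m => hδ_nonneg (m + n)
      refine (dRho_triangle ρ S (C.T U n) T).trans_lt ?_
      rw [dRho_comm ρ S]
      refine (add_le_add h₁ (hn ▸ h₂)).trans_lt ?_
      rw [← ENNReal.ofReal_add h₀ h₀, ENNReal.ofReal_lt_ofReal_iff (hε_pos M)]
      linarith
    cases M with
    -- No words are shared, but `T_0` is the same for all sequences.
    | zero => exact hclose 0 rfl (by linarith [htail 0, hε_pos 0])
    | succ M =>
      refine hclose M (C.T_eq hU hW fun m hm => hUW m (by omega)) ?_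
      -- The first term of the tail is split off, since the tail hypothesis at `M + 1` controls only
      -- the later ones.
      have := ((summable_nat_add_iff M).2 hδ_sum).tsum_eq_zero_add
      rw [this, tsum_congr fun m => by rw [show m + 1 + M + 1 = m + (M + 1) + 1 by omega],
        zero_add]
      linarith [htail (M + 1), hε_pos (M + 1)]
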